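/- Let $X$ be a complete metric space and let $p \ge 1$ be a real number. Definitions. A probability measure on $X$ is a Borel probability measure; it is Radon if $\mu(B)=\sup\{\mu(C) : C\subseteq B,\ C \text{ compact}\}$ for every Borel set $B$, and it has finite moment of order $p$ if $\int d(x_0,x)^p\,\mathrm{d}\mu(x)<\infty$ for some $x_0\in X$. Let $P_p(X)$ be the set of Radon probability measures on $X$ with finite moment of order $p$, equipped with the Wasserstein distance $$W_p(\mu,\nu)=\Big(\inf_\gamma \int d(x,y)^p\,\mathrm{d}\gamma(x,y)\Big)^{1/p},$$ where $\gamma$ runs over the couplings between $\mu$ and $\nu$, i.e. the Borel probability measures on the topological product $X\times X$ with marginals $\mu$ and $\nu$, and with the operations $\mu+_r\nu=r\mu+(1-r)\nu$ for $r\in[0,1]$. Let $\delta:X\to P_p(X)$ send $x$ to the Dirac measure at $x$. A barycentric algebra is a set $A$ with binary operations $+_r$ for $r\in[0,1]$ such that $x+_1y=x$, $x+_rx=x$, $x+_ry=y+_{1-r}x$, and $(x+_qy)+_rz=x+_{qr}\big(y+_{\frac{r-qr}{1-qr}}z\big)$ whenever $q<1$ and $r<1$; a map between barycentric algebras is affine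 if it preserves all the operations $+_r$. A Wasserstein algebra of order $p$ is a metric space $A$ that is also a barycentric algebra, whose operations $+_r:A\times A\to A$ are nonexpansive for the max metric on $A\times A$, and which satisfies $$d(x+_ry,\,x'+_ry')^p\le r\,d(x,x')^p+(1-r)\,d(y,y')^p$$ for all $r\in[0,1]$ and $x,x',y,y'\in A$. It is complete if its metric is complete. Theorem. $W_p$ is a (finite) metric on $P_p(X)$, and with this metric and the operations $+_r$, $P_p(X)$ is the free complete Wasserstein algebra of order $p$ over $X$, with universal arrow $\delta$. That is: $P_p(X)$ is a complete Wasserstein algebra of order $p$; $\delta$ is nonexpansive; and for every complete Wasserstein algebra $B$ of order $p$ and every nonexpansive map $f:X\to B$ there is a unique nonexpansive affine map $h:P_p(X)\to B$ with $h\circ\delta=f$. -/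

import Mathlib

open MeasureTheory
open scoped ENNReal

universe u v w

noncomputable section

namespace WassersteinAlgebra

/-- The weight `(r - q r) / (1 - q r)` of the skew associativity law. -/
def skewWeight (q r : unitInterval) : unitInterval :=
  ⟨((r : ℝ) - q * r) / (1 - q * r), by
    have hq0 := q.2.1
    have hq1 := q.2.2
    have hr0 := r.2.1
    have hr1 := r.2.2
    have h1 : (q : ℝ) * r ≤ r := mul_le_of_le_one_left hr0 hq1
    exact ⟨div_nonneg (by linarith) (by linarith),
      div_le_one_of_le₀ (by linarith) (by linarith)⟩⟩

/-- Barycentric algebras (abstract convex sets): `conv r x y` is the binary convex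
combination `x +_r y`, which takes `x` with weight `r` and `y` with weight `1 - r`. -/
class BarycentricAlgebra (A : Type*) where
  /-- The operation `x +_r y`. -/
  conv : unitInterval → A → A → A
  conv_one : ∀ x y : A, conv 1 x y = x
  conv_self : ∀ (r : unitInterval) (x : A), conv r x x = x
  conv_comm : ∀ (r : unitInterval) (x y : A), conv r x y = conv (unitInterval.symm r) y x
  conv_assoc : ∀ (q r : unitInterval), q < 1 → r < 1 → ∀ x y z : A,
    conv r (conv q x y) z = conv (q * r) x (conv (skewWeight q r) y z)

/-- Affine maps: homomorphisms of barycentric algebras. -/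
def IsAffine {A B : Type*} [BarycentricAlgebra A] [BarycentricAlgebra B] (h : A → B) : Prop :=
  ∀ (r : unitInterval) (x y : A),
    h (BarycentricAlgebra.conv r x y) = BarycentricAlgebra.conv r (h x) (h y)

/-- A metric space with a barycentric structure is a Wasserstein algebra of order `p` if the
operations are nonexpansive (`A × A` carries the max metric) and the Wasserstein condition of
order `p` holds. -/
structure IsWassersteinAlgebra (p : ℝ) (A : Type*) [MetricSpace A] [BarycentricAlgebra A] :
    Prop where
  nonexpansive : ∀ r : unitInterval,
    LipschitzWith 1 (fun z : A × A => BarycentricAlgebra.conv r z.1 z.2)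
  wasserstein : ∀ (r : unitInterval) (x x' y y' : A),
    dist (BarycentricAlgebra.conv r x y) (BarycentricAlgebra.conv r x' y') ^ p
      ≤ (r : ℝ) * dist x x' ^ p + (1 - (r : ℝ)) * dist y y' ^ p

/-- `A` is the free complete Wasserstein algebra of order `p` over the metric space `X`, with
universal arrow `η`: it is a complete Wasserstein algebra of order `p`, `η` is nonexpansive, and
every nonexpansive map from `X` to a complete Wasserstein algebra `B` of order `p` extends
uniquely along `η` to a nonexpansive affine map `A → B`. -/
structure IsFreeCompleteWassersteinAlgebra (p : ℝ) {X : Type u} {A : Type v}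
    [MetricSpace X] [MetricSpace A] [BarycentricAlgebra A] (η : X → A) : Prop where
  complete : CompleteSpace A
  isWassersteinAlgebra : IsWassersteinAlgebra p A
  nonexpansive : LipschitzWith 1 η
  existsUnique_extension : ∀ (B : Type w) [MetricSpace B] [CompleteSpace B]
    [BarycentricAlgebra B], IsWassersteinAlgebra p B →
    ∀ f : X → B, LipschitzWith 1 f →
      ∃! h : A → B, LipschitzWith 1 h ∧ IsAffine h ∧ ∀ x, h (η x) = f x

/-- Finite moment of order `p`. -/
def HasFiniteMoment (p : ℝ) {X : Type*} [MetricSpace X] [MeasurableSpace X] (μ : Measure X) :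
    Prop :=
  ∃ x₀ : X, ∫⁻ x, edist x₀ x ^ p ∂μ < ∞

/-- The Radon probability measures on `X` with finite moment of order `p`. For the Borel
σ-algebra, `Measure.InnerRegular` says that every Borel set is compact inner regular. -/
@[ext]
structure Pp (p : ℝ) (X : Type*) [MetricSpace X] [MeasurableSpace X] where
  /-- The underlying measure. -/
  toMeasure : Measure X
  isProbabilityMeasure : IsProbabilityMeasure toMeasure
  radon : toMeasure.InnerRegular
  hasFiniteMoment : HasFiniteMoment p toMeasure

/-- `γ` is a coupling between `μ` and `ν`: a probability measure on the Borel σ-algebra of the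
topological product `X × X` (in general larger than the product σ-algebra) with marginals
`μ` and `ν`. -/
structure IsCoupling {X : Type*} [MetricSpace X] [MeasurableSpace X]
    (γ : @Measure (X × X) (borel (X × X))) (μ ν : Measure X) : Prop where
  isProbabilityMeasure : @IsProbabilityMeasure (X × X) (borel (X × X)) γ
  map_fst : @Measure.map (X × X) X (borel (X × X)) _ Prod.fst γ = μ
  map_snd : @Measure.map (X × X) X (borel (X × X)) _ Prod.snd γ = ν

/-- The Wasserstein distance of order `p`, as an extended nonnegative real:
`(inf_γ ∫ d^p dγ)^(1/p)`, where `γ` runs over the couplings between `μ` and `ν`. -/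
def wassersteinDist (p : ℝ) {X : Type*} [MetricSpace X] [MeasurableSpace X] (μ ν : Measure X) :
    ℝ≥0∞ :=
  (⨅ (γ : @Measure (X × X) (borel (X × X))) (_ : IsCoupling γ μ ν),
    ∫⁻ z, edist z.1 z.2 ^ p ∂γ) ^ (1 / p)

section Pp

variable {p : ℝ} {X : Type*} [MetricSpace X] [MeasurableSpace X]

theorem HasFiniteMoment.all [Fact (1 ≤ p)] [BorelSpace X] {μ : Measure X} [IsFiniteMeasure μ]
    (h : HasFiniteMoment p μ) (y : X) : ∫⁻ x, edist y x ^ p ∂μ < ∞ := by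
  obtain ⟨x₀, hx₀⟩ := h
  have hp : 1 ≤ p := Fact.out
  have hm : Measurable fun x => edist x₀ x ^ p :=
    (measurable_edist_right).pow_const p
  calc ∫⁻ x, edist y x ^ p ∂μ
      ≤ ∫⁻ x, (2 : ℝ≥0∞) ^ (p - 1) * (edist y x₀ ^ p + edist x₀ x ^ p) ∂μ := by
        refine lintegral_mono fun x => ?_
        exact (ENNReal.rpow_le_rpow (edist_triangle y x₀ x) (by linarith)).trans
          (ENNReal.rpow_add_le_mul_rpow_add_rpow _ _ hp)
    _ = (2 : ℝ≥0∞) ^ (p - 1) * (edist y x₀ ^ p * μ Set.univ + ∫⁻ x, edist x₀ x ^ p ∂μ) := by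
        rw [lintegral_const_mul _ (hm.const_add _), lintegral_add_right _ hm, lintegral_const]
    _ < ∞ := by
        have h1 : edist y x₀ ^ p < ∞ := ENNReal.rpow_lt_top_of_nonneg (by linarith) (edist_ne_top _ _)
        have h2 : (2 : ℝ≥0∞) ^ (p - 1) < ∞ :=
          ENNReal.rpow_lt_top_of_nonneg (by linarith) (by norm_num)
        exact ENNReal.mul_lt_top h2
          (ENNReal.add_lt_top.2 ⟨ENNReal.mul_lt_top h1 (measure_lt_top _ _), hx₀⟩)

/-- The measure `r μ + (1 - r) ν`. -/
def convMeasure (r : unitInterval) (μ ν : Measure X) : Measure X :=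
  ENNReal.ofReal r • μ + ENNReal.ofReal (1 - r) • ν

/-- The convex combination `μ +_r ν`, given on Borel sets by
`(μ +_r ν) B = r μ B + (1 - r) ν B`. -/
def Pp.conv [Fact (1 ≤ p)] [BorelSpace X] (r : unitInterval) (μ ν : Pp p X) : Pp p X where
  toMeasure := convMeasure r μ.toMeasure ν.toMeasure
  isProbabilityMeasure := by
    have := μ.isProbabilityMeasure
    have := ν.isProbabilityMeasure
    constructor
    simp only [convMeasure, Measure.coe_add, Measure.coe_smul, Pi.add_apply, Pi.smul_apply,
      measure_univ, smul_eq_mul, mul_one]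
    rw [← ENNReal.ofReal_add r.2.1 (by linarith [r.2.2])]
    simp
  radon := by
    have := μ.radon
    have := ν.radon
    unfold convMeasure
    infer_instance
  hasFiniteMoment := by
    have := μ.isProbabilityMeasure
    have := ν.isProbabilityMeasure
    obtain ⟨x₀, hx₀⟩ := μ.hasFiniteMoment
    have hν := ν.hasFiniteMoment.all x₀
    refine ⟨x₀, ?_⟩
    unfold convMeasure
    rw [lintegral_add_measure, lintegral_smul_measure, lintegral_smul_measure]
    simp only [smul_eq_mul]
    exact ENNReal.add_lt_top.2 ⟨ENNReal.mul_lt_top ENNReal.ofReal_lt_top hx₀,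
      ENNReal.mul_lt_top ENNReal.ofReal_lt_top hν⟩

theorem ofReal_smul_smul {X : Type*} [MeasurableSpace X] {a b : ℝ} (ha : 0 ≤ a) (μ : Measure X) :
    ENNReal.ofReal a • ENNReal.ofReal b • μ = ENNReal.ofReal (a * b) • μ := by
  rw [smul_smul, ENNReal.ofReal_mul ha]

instance [Fact (1 ≤ p)] [BorelSpace X] : BarycentricAlgebra (Pp p X) where
  conv := Pp.conv
  conv_one μ ν := by
    ext1
    simp [Pp.conv, convMeasure]
  conv_self r μ := by
    ext1
    simp only [Pp.conv, convMeasure]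
    rw [← add_smul, ← ENNReal.ofReal_add r.2.1 (by linarith [r.2.2])]
    simp
  conv_comm r μ ν := by
    ext1
    simp [Pp.conv, convMeasure, add_comm]
  conv_assoc q r hq hr μ ν ξ := by
    ext1
    have hq0 := q.2.1
    have hq1 : (q : ℝ) < 1 := hq
    have hr0 := r.2.1
    have hr1 : (r : ℝ) < 1 := hr
    have h1 : (q : ℝ) * r < 1 := by nlinarith
    have h2 : (1 - (q : ℝ) * r) ≠ 0 := by linarith
    have h3 : (0 : ℝ) ≤ 1 - q * r := by linarith
    simp only [Pp.conv, convMeasure, smul_add, ofReal_smul_smul hr0,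
      Set.Icc.coe_mul, ofReal_smul_smul h3]
    have e1 : (1 - (q : ℝ) * r) * (skewWeight q r : ℝ) = r * (1 - q) := by
      simp only [skewWeight]
      field_simp
    have e2 : (1 - (q : ℝ) * r) * (1 - (skewWeight q r : ℝ)) = 1 - r := by
      rw [mul_sub, e1]; ring
    rw [e1, e2, mul_comm (r : ℝ) q, add_assoc]

/-- The Dirac delta function `X → Pp p X`. -/
def Pp.dirac (p : ℝ) [Fact (1 ≤ p)] [BorelSpace X] (x : X) : Pp p X where
  toMeasure := Measure.dirac x
  isProbabilityMeasure := inferInstance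
  radon := by
    refine ⟨fun U hU r hr => ⟨U ∩ {x}, Set.inter_subset_left, ?_, ?_⟩⟩
    · exact ((Set.finite_singleton x).inter_of_right U).isCompact
    · rw [Measure.dirac_apply' _ hU] at hr
      rw [Measure.dirac_apply' _ (hU.inter (measurableSet_singleton x))]
      by_cases hx : x ∈ U <;> simp_all
  hasFiniteMoment := by
    have hp : (1 : ℝ) ≤ p := Fact.out
    refine ⟨x, ?_⟩
    rw [lintegral_dirac, edist_self, ENNReal.zero_rpow_of_pos (by linarith)]
    exact ENNReal.zero_lt_top

end Pp

end WassersteinAlgebra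

end

/-!
A barycentric algebra embeds in a cone over it, which is an `ℝ≥0`-module, so that finite convex
combinations become linear combinations, and the Wasserstein condition says that the cost of
transporting one element of the cone to another is subadditive.

Countably many Radon measures live on a common separable closed set, and finitely many on a common
σ-compact set. There couplings are Borel measures on a standard Borel space, so they disintegrate
and can be glued along common marginals. Gluing two couplings gives the triangle inequality. Gluing
infinitely many realizes a rapidly Cauchy sequence of measures as the laws of random points that
converge almost surely, and the law of their limit is the limit in `W_p`.

Finitely supported measures are dense, and an affine map on them is given by barycenters. A coupling
of two of them is finitely supported, so subadditivity of the cost shows that the barycenter of the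
image measure under a nonexpansive map depends nonexpansively on the measure. The universal property
follows by continuous extension.
-/

noncomputable section

namespace WassersteinAlgebra

open scoped NNReal
open unitInterval (toNNReal)
open BarycentricAlgebra (conv conv_one conv_self conv_comm conv_assoc)

/-! ### The cone over a barycentric algebra -/

section Cone

/-- The weight `s / (s + t)` of the first point in the barycenter of two points with weights `s`
and `t`; it is `0` if `s = t = 0`. -/
def ratio (s t : ℝ≥0) : unitInterval :=
  ⟨((s / (s + t) : ℝ≥0) : ℝ), NNReal.coe_nonneg _,
    NNReal.coe_le_one.2 (div_le_one_of_le₀ le_self_add (zero_le))⟩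

theorem coe_ratio (s t : ℝ≥0) : (ratio s t : ℝ) = s / (s + t) := by
  simp [ratio]

theorem symm_ratio {s t : ℝ≥0} (hs : s ≠ 0) : unitInterval.symm (ratio s t) = ratio t s := by
  ext
  have : (s : ℝ) + t ≠ 0 := by positivity
  rw [unitInterval.coe_symm_eq, coe_ratio, coe_ratio, add_comm (t : ℝ)]
  field_simp
  ring

theorem ratio_lt_one {s t : ℝ≥0} (ht : t ≠ 0) : ratio s t < 1 := by
  have : (0 : ℝ) < t := by positivity
  rw [← Subtype.coe_lt_coe, coe_ratio, Set.Icc.coe_one, div_lt_one (by positivity)]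
  exact lt_add_of_pos_right _ this

theorem ratio_mul_ratio {s t u : ℝ≥0} (hs : s ≠ 0) :
    ratio s t * ratio (s + t) u = ratio s (t + u) := by
  ext
  have : (s : ℝ) + t ≠ 0 := by positivity
  simp only [Set.Icc.coe_mul, coe_ratio, NNReal.coe_add]
  rw [div_mul_div_cancel₀ this, add_assoc]

theorem skewWeight_ratio {s t u : ℝ≥0} (hs : s ≠ 0) :
    skewWeight (ratio s t) (ratio (s + t) u) = ratio t u := by
  ext
  have hsum : (s : ℝ) + (t + u) ≠ 0 := by positivity
  have hmul : (ratio s t : ℝ) * ratio (s + t) u = s / (s + (t + u)) := by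
    rw [← Set.Icc.coe_mul, ratio_mul_ratio hs, coe_ratio, NNReal.coe_add]
  simp only [skewWeight, hmul]
  rw [coe_ratio, coe_ratio, NNReal.coe_add, add_assoc (s : ℝ), ← sub_div, one_sub_div hsum,
    div_div_div_cancel_right₀ hsum, add_sub_cancel_left, add_sub_cancel_left]

theorem mul_ratio_mul_left {c : ℝ≥0} (hc : c ≠ 0) (s t : ℝ≥0) :
    ratio (c * s) (c * t) = ratio s t := by
  ext
  rw [coe_ratio, coe_ratio, NNReal.coe_mul, NNReal.coe_mul, ← mul_add,
    mul_div_mul_left _ _ (NNReal.coe_ne_zero.2 hc)]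

theorem add_mul_ratio (s t : ℝ≥0) : (s + t) * toNNReal (ratio s t) = s :=
  mul_div_cancel_of_imp' fun h => (add_eq_zero.1 h).1

theorem add_mul_symm_ratio (s t : ℝ≥0) :
    (s + t) * toNNReal (unitInterval.symm (ratio s t)) = t := by
  rw [← add_right_inj ((s + t) * toNNReal (ratio s t)), ← mul_add,
    unitInterval.toNNReal_add_toNNReal_symm, mul_one, add_mul_ratio]

theorem ratio_toNNReal (r : unitInterval) :
    ratio (toNNReal r) (toNNReal (unitInterval.symm r)) = r := by
  ext
  rw [coe_ratio, ← NNReal.coe_add, unitInterval.toNNReal_add_toNNReal_symm, NNReal.coe_one,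
    div_one, unitInterval.coe_toNNReal]

theorem toNNReal_ne_zero {r : unitInterval} (hr : r ≠ 0) : toNNReal r ≠ 0 := fun h =>
  hr (Subtype.ext (congrArg NNReal.toReal h))

theorem conv_zero {A : Type*} [BarycentricAlgebra A] (x y : A) : conv 0 x y = y := by
  rw [conv_comm, unitInterval.symm_zero, conv_one]

/-- The cone over `A`: the points of `A` with positive weights, and a zero. If `A` is a
barycentric algebra then its cone is an `ℝ≥0`-module, in which finite barycenters in `A` can be
computed as linear combinations. -/
inductive Cone (A : Type*) : Type _
  | zero : Cone A
  | pos (t : ℝ≥0) (ht : t ≠ 0) (a : A) : Cone A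

namespace Cone

variable {A : Type*}

instance : Zero (Cone A) := ⟨zero⟩

instance : SMul ℝ≥0 (Cone A) where
  smul
    | _, zero => zero
    | c, pos s hs x => if hc : c = 0 then zero else pos (c * s) (mul_ne_zero hc hs) x

theorem zero_eq : (zero : Cone A) = 0 := rfl

theorem smul_pos {c s : ℝ≥0} (hc : c ≠ 0) (hs : s ≠ 0) (x : A) :
    c • pos s hs x = pos (c * s) (mul_ne_zero hc hs) x := dif_neg hc

protected theorem zero_smul (u : Cone A) : (0 : ℝ≥0) • u = 0 := by
  cases u
  · rfl
  · exact dif_pos rfl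

protected theorem smul_zero (c : ℝ≥0) : c • (0 : Cone A) = 0 := rfl

protected theorem mul_smul (c d : ℝ≥0) (u : Cone A) : (c * d) • u = c • d • u := by
  rcases eq_or_ne c 0 with rfl | hc
  · simp only [Cone.zero_smul, zero_mul]
  rcases eq_or_ne d 0 with rfl | hd
  · simp only [Cone.zero_smul, mul_zero, Cone.smul_zero]
  cases u with
  | zero => rfl
  | pos s hs x => simp only [smul_pos hc, smul_pos hd, smul_pos (mul_ne_zero hc hd), mul_assoc]

/-- The inclusion of `A` into its cone as the points of weight one. -/
def ι (x : A) : Cone A := pos 1 one_ne_zero x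

theorem ι_injective : Function.Injective (ι : A → Cone A) := fun x y h => by
  simpa [ι] using h

theorem smul_ι {c : ℝ≥0} (hc : c ≠ 0) (x : A) : c • ι x = pos c hc x := by
  simp only [ι, smul_pos hc, mul_one]

variable [BarycentricAlgebra A]

instance : Add (Cone A) where
  add
    | zero, v => v
    | u, zero => u
    | pos s hs x, pos t _ y => pos (s + t) (by positivity) (conv (ratio s t) x y)

theorem pos_add_pos {s t : ℝ≥0} (hs : s ≠ 0) (ht : t ≠ 0) (x y : A) :
    pos s hs x + pos t ht y = pos (s + t) (by positivity) (conv (ratio s t) x y) := rfl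

protected theorem zero_add (u : Cone A) : 0 + u = u := rfl

protected theorem add_zero (u : Cone A) : u + 0 = u := by cases u <;> rfl

protected theorem add_comm (u v : Cone A) : u + v = v + u := by
  cases u with
  | zero => rw [zero_eq, Cone.zero_add, Cone.add_zero]
  | pos s hs x =>
    cases v with
    | zero => rw [zero_eq, Cone.zero_add, Cone.add_zero]
    | pos t ht y => simp only [pos_add_pos, add_comm t s, conv_comm (ratio s t), symm_ratio hs]

protected theorem add_assoc (u v z : Cone A) : u + v + z = u + (v + z) := by
  cases u with
  | zero => simp only [zero_eq, Cone.zero_add]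
  | pos s hs x =>
    cases v with
    | zero => simp only [zero_eq, Cone.zero_add, Cone.add_zero]
    | pos t ht y =>
      cases z with
      | zero => simp only [zero_eq, Cone.add_zero]
      | pos r hr z =>
        simp only [pos_add_pos, add_assoc s t r]
        rw [conv_assoc _ _ (ratio_lt_one ht) (ratio_lt_one hr), ratio_mul_ratio hs,
          skewWeight_ratio hs]

instance : AddCommMonoid (Cone A) where
  add_assoc := Cone.add_assoc
  zero_add := Cone.zero_add
  add_zero := Cone.add_zero
  add_comm := Cone.add_comm
  nsmul := nsmulRec

protected theorem smul_add (c : ℝ≥0) (u v : Cone A) : c • (u + v) = c • u + c • v := by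
  rcases eq_or_ne c 0 with rfl | hc
  · simp only [Cone.zero_smul, add_zero]
  cases u with
  | zero => simp only [zero_eq, zero_add, Cone.smul_zero]
  | pos s hs x =>
    cases v with
    | zero => simp only [zero_eq, add_zero, Cone.smul_zero]
    | pos t ht y => simp only [pos_add_pos, smul_pos hc, mul_add, mul_ratio_mul_left hc]

protected theorem add_smul (c d : ℝ≥0) (u : Cone A) : (c + d) • u = c • u + d • u := by
  rcases eq_or_ne c 0 with rfl | hc
  · simp only [Cone.zero_smul, zero_add]
  rcases eq_or_ne d 0 with rfl | hd
  · simp only [Cone.zero_smul, add_zero]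
  cases u with
  | zero => simp only [zero_eq, add_zero, Cone.smul_zero]
  | pos s hs x =>
    have hcd : c + d ≠ 0 := by positivity
    simp only [smul_pos hc, smul_pos hd, smul_pos hcd, pos_add_pos, conv_self, add_mul]

instance : Module ℝ≥0 (Cone A) where
  one_smul u := by
    cases u
    · rfl
    · simp only [smul_pos one_ne_zero, one_mul]
  mul_smul := Cone.mul_smul
  smul_zero := Cone.smul_zero
  smul_add := Cone.smul_add
  add_smul := Cone.add_smul
  zero_smul := Cone.zero_smul

/-- A map from a barycentric algebra to an `ℝ≥0`-module preserves convex combinations if it is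
affine for the barycentric operations `r • m + (1 - r) • m'` of the module. -/
def PreservesConv {M : Type*} [AddCommMonoid M] [Module ℝ≥0 M] (φ : A → M) : Prop :=
  ∀ (r : unitInterval) (x y : A),
    φ (conv r x y) = toNNReal r • φ x + toNNReal (unitInterval.symm r) • φ y

theorem preservesConv_ι : PreservesConv (ι : A → Cone A) := by
  intro r x y
  rcases eq_or_ne r 0 with rfl | hr
  · simp only [conv_zero, unitInterval.toNNReal_zero, unitInterval.symm_zero,
      unitInterval.toNNReal_one, zero_smul, one_smul, zero_add]
  rcases eq_or_ne (unitInterval.symm r) 0 with hr' | hr'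
  · obtain rfl : r = 1 := unitInterval.symm_eq_zero.1 hr'
    simp only [conv_one, unitInterval.toNNReal_zero, unitInterval.symm_one,
      unitInterval.toNNReal_one, zero_smul, one_smul, add_zero]
  · rw [smul_ι (toNNReal_ne_zero hr), smul_ι (toNNReal_ne_zero hr'), pos_add_pos, ratio_toNNReal]
    simp only [unitInterval.toNNReal_add_toNNReal_symm, ι]

theorem isAffine_iff_preservesConv {B : Type*} [BarycentricAlgebra B] {h : A → B} :
    IsAffine h ↔ PreservesConv fun x => ι (h x) := by
  refine forall_congr' fun r => forall_congr' fun x => forall_congr' fun y => ?_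
  rw [← preservesConv_ι, ι_injective.eq_iff]

/-- The linear extension to the cone of a map that preserves convex combinations. -/
def lift {M : Type*} [AddCommMonoid M] [Module ℝ≥0 M] (φ : A → M) (hφ : PreservesConv φ) :
    Cone A →ₗ[ℝ≥0] M where
  toFun
    | zero => 0
    | pos t _ x => t • φ x
  map_add' u v := by
    cases u with
    | zero => simp only [zero_eq, zero_add]
    | pos s hs x =>
      cases v with
      | zero => simp only [add_zero]
      | pos t ht y =>
        simp only [hφ (ratio s t), smul_add, smul_smul, add_mul_ratio,
          add_mul_symm_ratio]
  map_smul' c u := by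
    rcases eq_or_ne c 0 with rfl | hc
    · simp only [zero_smul, RingHom.id_apply]
    cases u with
    | zero => simp only [zero_eq, smul_zero]
    | pos s hs x => simp only [smul_pos hc, smul_smul, RingHom.id_apply]

theorem lift_ι {M : Type*} [AddCommMonoid M] [Module ℝ≥0 M] (φ : A → M) (hφ : PreservesConv φ)
    (x : A) : lift φ hφ (ι x) = φ x :=
  one_smul _ _

/-- The total weight, as a linear form on the cone; the points of `A` are the elements of mass
one. -/
def mass : Cone A →ₗ[ℝ≥0] ℝ≥0 :=
  lift (fun _ => 1) fun r _ _ => by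
    simp only [smul_eq_mul, mul_one, unitInterval.toNNReal_add_toNNReal_symm]

theorem mass_ι (x : A) : mass (ι x) = 1 := lift_ι ..

theorem exists_ι_eq {u : Cone A} (hu : mass u = 1) : ∃ x, ι x = u := by
  cases u with
  | zero => exact absurd hu zero_ne_one
  | pos t ht x =>
    obtain rfl : t = 1 := by simpa [mass, lift] using hu
    exact ⟨x, rfl⟩

end Cone

end Cone

/-! ### The Wasserstein condition -/

section WassersteinCondition

variable {p : ℝ} {A : Type*} [MetricSpace A]

namespace Cone

/-- The cost of transporting one point mass of the cone to another: the weight times the `p`-th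
power of the distance of the points, and `∞` if the weights differ. -/
def cost (p : ℝ) : Cone A → Cone A → ℝ≥0∞
  | zero, zero => 0
  | pos s _ x, pos t _ y => if s = t then s * edist x y ^ p else ∞
  | _, _ => ∞

theorem cost_pos_pos {s : ℝ≥0} (hs : s ≠ 0) (x y : A) :
    cost p (pos s hs x) (pos s hs y) = s * edist x y ^ p :=
  if_pos rfl

theorem cost_smul_ι (c : ℝ≥0) (x y : A) :
    cost p (c • ι x) (c • ι y) = c * edist x y ^ p := by
  rcases eq_or_ne c 0 with rfl | hc
  · rw [Cone.zero_smul, Cone.zero_smul, ENNReal.coe_zero, zero_mul]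
    rfl
  · rw [smul_ι hc, smul_ι hc, cost_pos_pos]

end Cone

theorem rpow_dist_le_iff_rpow_edist_le (hp : 0 ≤ p) (r : unitInterval) (x x' y y' z z' : A) :
    dist z z' ^ p ≤ (r : ℝ) * dist x x' ^ p + (1 - (r : ℝ)) * dist y y' ^ p ↔
      edist z z' ^ p ≤ toNNReal r * edist x x' ^ p
        + toNNReal (unitInterval.symm r) * edist y y' ^ p := by
  have hdist (a b : A) : edist a b ^ p = ((nndist a b ^ p : ℝ≥0) : ℝ≥0∞) := by
    rw [edist_nndist, ENNReal.coe_rpow_of_nonneg _ hp]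
  rw [hdist, hdist, hdist]
  norm_cast

variable [BarycentricAlgebra A]

/-- The inequality contains nonexpansiveness, because a power mean is at most the maximum. -/
theorem isWassersteinAlgebra_iff (hp : 0 < p) :
    IsWassersteinAlgebra p A ↔ ∀ (r : unitInterval) (x x' y y' : A),
      edist (conv r x y) (conv r x' y') ^ p ≤ toNNReal r * edist x x' ^ p
        + toNNReal (unitInterval.symm r) * edist y y' ^ p := by
  refine ⟨fun h r x x' y y' => (rpow_dist_le_iff_rpow_edist_le hp.le ..).1 (h.wasserstein ..),
    fun h => ⟨fun r => ?_, fun r x x' y y' => (rpow_dist_le_iff_rpow_edist_le hp.le ..).2 (h ..)⟩⟩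
  intro z z'
  rw [ENNReal.coe_one, one_mul, ← ENNReal.rpow_le_rpow_iff hp]
  calc edist (conv r z.1 z.2) (conv r z'.1 z'.2) ^ p
      ≤ toNNReal r * edist z.1 z'.1 ^ p
        + toNNReal (unitInterval.symm r) * edist z.2 z'.2 ^ p := h ..
    _ ≤ toNNReal r * edist z z' ^ p + toNNReal (unitInterval.symm r) * edist z z' ^ p := by
        gcongr
        exacts [le_max_left _ _, le_max_right _ _]
    _ = edist z z' ^ p := by
        rw [← add_mul, ← ENNReal.coe_add, unitInterval.toNNReal_add_toNNReal_symm,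
          ENNReal.coe_one, one_mul]

namespace Cone

theorem cost_add_le (hp : 0 < p) (hA : IsWassersteinAlgebra p A) (u v u' v' : Cone A) :
    cost p (u + u') (v + v') ≤ cost p u v + cost p u' v' := by
  match u, v, u', v' with
  | zero, zero, u', v' => exact le_add_self
  | u, v, zero, zero => simp only [zero_eq, add_zero, le_self_add]
  | zero, pos .., _, _ | pos .., zero, _, _ => exact le_top.trans_eq (top_add _).symm
  | _, _, zero, pos .. | _, _, pos .., zero => exact le_top.trans_eq (add_top _).symm
  | pos s hs x, pos t ht y, pos s' hs' x', pos t' ht' y' =>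
    rcases ne_or_eq s t with hst | rfl
    · exact le_top.trans_eq (by rw [cost, if_neg hst, top_add])
    rcases ne_or_eq s' t' with hst' | rfl
    · exact le_top.trans_eq (by rw [cost, cost, if_neg hst', add_top])
    simp only [pos_add_pos, cost_pos_pos]
    calc ((s + s' : ℝ≥0) : ℝ≥0∞) * edist (conv (ratio s s') x x') (conv (ratio s s') y y') ^ p
        ≤ (s + s' : ℝ≥0) * (toNNReal (ratio s s') * edist x y ^ p
          + toNNReal (unitInterval.symm (ratio s s')) * edist x' y' ^ p) := by
          gcongr
          exact (isWassersteinAlgebra_iff hp).1 hA ..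
      _ = s * edist x y ^ p + s' * edist x' y' ^ p := by
          rw [mul_add, ← mul_assoc, ← mul_assoc, ← ENNReal.coe_mul, ← ENNReal.coe_mul,
            add_mul_ratio, add_mul_symm_ratio]

theorem cost_linearCombination_le (hp : 0 < p) (hA : IsWassersteinAlgebra p A) {I : Type*}
    (w : I →₀ ℝ≥0) (x y : I → A) :
    cost p (Finsupp.linearCombination ℝ≥0 (ι ∘ x) w) (Finsupp.linearCombination ℝ≥0 (ι ∘ y) w)
      ≤ w.sum fun i c => c * edist (x i) (y i) ^ p := by
  induction w using Finsupp.induction_linear with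
  | zero => simp only [map_zero, Finsupp.sum_zero_index]; rfl
  | add v w hv hw =>
    rw [map_add, map_add, Finsupp.sum_add_index' (by simp) (by simp [add_mul])]
    exact (cost_add_le hp hA ..).trans (add_le_add hv hw)
  | single i c =>
    rw [Finsupp.linearCombination_single, Finsupp.linearCombination_single,
      Finsupp.sum_single_index (by simp), Function.comp_apply, Function.comp_apply, cost_smul_ι]

end Cone

end WassersteinCondition

/-! ### Finitely supported measures -/

section DiscreteMeasure

variable {Ω : Type*} [MeasurableSpace Ω]

/-- The measure with finitely many atoms `x`, of weights `w x`. -/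
def discreteMeasure : (Ω →₀ ℝ≥0) →ₗ[ℝ≥0] Measure Ω :=
  Finsupp.linearCombination ℝ≥0 Measure.dirac

theorem discreteMeasure_single (x : Ω) (c : ℝ≥0) :
    discreteMeasure (Finsupp.single x c) = c • Measure.dirac x :=
  Finsupp.linearCombination_single ℝ≥0 c x

theorem map_discreteMeasure {Ω' : Type*} [MeasurableSpace Ω'] {f : Ω → Ω'} (hf : Measurable f)
    (w : Ω →₀ ℝ≥0) : (discreteMeasure w).map f = discreteMeasure (w.mapDomain f) := by
  induction w using Finsupp.induction_linear with
  | zero => simp only [map_zero, Finsupp.mapDomain_zero, Measure.map_zero]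
  | add v w hv hw => rw [Finsupp.mapDomain_add, map_add, map_add, Measure.map_add _ _ hf, hv, hw]
  | single x c =>
    rw [Finsupp.mapDomain_single, discreteMeasure_single, discreteMeasure_single,
      Measure.map_smul, Measure.map_dirac' hf]

theorem lintegral_discreteMeasure [MeasurableSingletonClass Ω] (w : Ω →₀ ℝ≥0) (f : Ω → ℝ≥0∞) :
    ∫⁻ x, f x ∂discreteMeasure w = w.sum fun x c => c * f x := by
  induction w using Finsupp.induction_linear with
  | zero => rw [map_zero, lintegral_zero_measure, Finsupp.sum_zero_index]
  | add v w hv hw =>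
    rw [map_add, lintegral_add_measure, hv, hw,
      Finsupp.sum_add_index' (by simp) (by simp [add_mul])]
  | single x c =>
    rw [discreteMeasure_single, lintegral_smul_measure, lintegral_dirac,
      Finsupp.sum_single_index (by simp), ENNReal.smul_def, smul_eq_mul]

theorem discreteMeasure_singleton [MeasurableSingletonClass Ω] (w : Ω →₀ ℝ≥0) (x : Ω) :
    discreteMeasure w {x} = w x := by
  classical
  induction w using Finsupp.induction_linear with
  | zero => simp
  | add v w hv hw => simp [hv, hw]
  | single y c =>
    rw [discreteMeasure_single, Finsupp.single_apply]
    by_cases h : y = x <;> simp [h]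

theorem discreteMeasure_injective [MeasurableSingletonClass Ω] :
    Function.Injective (discreteMeasure : (Ω →₀ ℝ≥0) → Measure Ω) := fun v w h =>
  Finsupp.ext fun x => by
    rw [← ENNReal.coe_inj, ← discreteMeasure_singleton, ← discreteMeasure_singleton, h]

theorem discreteMeasure_compl_support [MeasurableSingletonClass Ω] (w : Ω →₀ ℝ≥0) :
    discreteMeasure w (w.support : Set Ω)ᶜ = 0 := by
  rw [← lintegral_indicator_one w.support.measurableSet.compl, lintegral_discreteMeasure]
  refine Finset.sum_eq_zero fun x hx => ?_
  simp only [Set.indicator_of_notMem (Set.notMem_compl_iff.2 hx), mul_zero]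

theorem sum_eq_one_of_isProbabilityMeasure [MeasurableSingletonClass Ω] {w : Ω →₀ ℝ≥0}
    [IsProbabilityMeasure (discreteMeasure w)] : w.sum (fun _ c => c) = 1 := by
  have h := lintegral_discreteMeasure w 1
  simp only [Pi.one_apply, lintegral_one, measure_univ, mul_one] at h
  exact_mod_cast h.symm

theorem mem_range_discreteMeasure_of_measure_compl [MeasurableSingletonClass Ω] {μ : Measure Ω}
    [IsFiniteMeasure μ] {s : Set Ω} (hs : s.Finite) (hμ : μ sᶜ = 0) :
    μ ∈ LinearMap.range (discreteMeasure (Ω := Ω)) := by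
  lift s to Finset Ω using hs
  have h : μ = ∑ x ∈ s, (μ {x}).toNNReal • Measure.dirac x := by
    conv_lhs => rw [Measure.ae_mem_finset_iff.1 hμ]
    refine Finset.sum_congr rfl fun x _ => ?_
    rw [ENNReal.smul_def, ENNReal.coe_toNNReal (measure_ne_top μ _)]
  rw [h]
  exact Submodule.sum_mem _ fun x _ => ⟨Finsupp.single x _, discreteMeasure_single x _⟩

theorem innerRegular_dirac [TopologicalSpace Ω] [MeasurableSingletonClass Ω] (x : Ω) :
    (Measure.dirac x).InnerRegular := by
  refine ⟨fun U hU r hr => ⟨U ∩ {x}, Set.inter_subset_left, ?_, ?_⟩⟩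
  · exact ((Set.finite_singleton x).inter_of_right U).isCompact
  · rw [Measure.dirac_apply' _ hU] at hr
    rw [Measure.dirac_apply' _ (hU.inter (measurableSet_singleton x))]
    by_cases hx : x ∈ U
    · simpa [hx] using hr
    · simp [hx] at hr

theorem innerRegular_discreteMeasure [TopologicalSpace Ω] [MeasurableSingletonClass Ω]
    (w : Ω →₀ ℝ≥0) : (discreteMeasure w).InnerRegular := by
  have := innerRegular_dirac (Ω := Ω)
  unfold discreteMeasure
  rw [Finsupp.linearCombination_apply, Finsupp.sum]
  infer_instance

end DiscreteMeasure

/-! ### Gluing along a common marginal -/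

section Gluing

open ProbabilityTheory Preorder

variable {α β E : Type*} [MeasurableSpace α] [MeasurableSpace β] [MeasurableSpace E]

theorem map_prodMap_compProd_comap (μ : Measure α) [SFinite μ] {g : α → β} (hg : Measurable g)
    (κ : Kernel β E) [IsSFiniteKernel κ] :
    (μ.compProd (κ.comap g hg)).map (Prod.map g id) = (μ.map g).compProd κ := by
  ext s hs
  have hgm : Measurable (Prod.map g (id : E → E)) := hg.prodMap measurable_id
  rw [Measure.map_apply hgm hs, Measure.compProd_apply (hgm hs), Measure.compProd_apply hs,
    lintegral_map (Kernel.measurable_kernel_prodMk_left hs) hg]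
  rfl

theorem map_eval_zero_trajMeasure (μ : Measure E)
    (κ : (n : ℕ) → Kernel (Finset.Iic n → E) E) [∀ n, IsMarkovKernel (κ n)] :
    (Kernel.trajMeasure (X := fun _ => E) μ κ).map (fun x => x 0) = μ := by
  have h₀ : (Kernel.trajMeasure (X := fun _ => E) μ κ).map (frestrictLe 0) =
      μ.map (MeasurableEquiv.piUnique (fun _ : Finset.Iic 0 => E)).symm := by
    rw [Kernel.trajMeasure, Measure.map_comp _ _ (by fun_prop), Kernel.traj_map_frestrictLe,
      Kernel.partialTraj_self, Measure.id_comp]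
  have heval : (fun x : ℕ → E => x 0) =
      MeasurableEquiv.piUnique (fun _ : Finset.Iic 0 => E) ∘ frestrictLe 0 := rfl
  rw [heval, ← Measure.map_map (by fun_prop) (by fun_prop), h₀,
    Measure.map_map (by fun_prop) (by fun_prop), MeasurableEquiv.self_comp_symm, Measure.map_id]

variable [StandardBorelSpace E] [Nonempty E]

theorem exists_measure_fst_eq_map_snd_eq (γ : Measure (α × β)) [IsProbabilityMeasure γ]
    (γ' : Measure (β × E)) [IsFiniteMeasure γ'] (h : γ.snd = γ'.fst) :
    ∃ P : Measure ((α × β) × E), IsProbabilityMeasure P ∧ P.fst = γ ∧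
      P.map (fun z => (z.1.2, z.2)) = γ' := by
  refine ⟨γ.compProd (γ'.condKernel.comap Prod.snd measurable_snd), inferInstance,
    Measure.fst_compProd .., ?_⟩
  refine (map_prodMap_compProd_comap γ measurable_snd γ'.condKernel).trans ?_
  rw [← Measure.snd, h, γ'.disintegrate]

theorem exists_measure_map_eval_eq (γ : ℕ → Measure (E × E)) [∀ n, IsProbabilityMeasure (γ n)]
    (hγ : ∀ n, (γ n).snd = (γ (n + 1)).fst) :
    ∃ P : Measure (ℕ → E), IsProbabilityMeasure P ∧
      ∀ n, P.map (fun x => (x n, x (n + 1))) = γ n := by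
  let last (n : ℕ) (x : Finset.Iic n → E) : E := x ⟨n, Finset.mem_Iic.2 le_rfl⟩
  have hlast (n : ℕ) : Measurable (last n) := measurable_pi_apply _
  let κ (n : ℕ) : Kernel (Finset.Iic n → E) E := (γ n).condKernel.comap (last n) (hlast n)
  let P : Measure (ℕ → E) := Kernel.trajMeasure (X := fun _ => E) (γ 0).fst κ
  have map_pair (n : ℕ) (h : P.map (fun x => x n) = (γ n).fst) :
      P.map (fun x => (x n, x (n + 1))) = γ n := by
    have htraj := congrArg (Measure.map (Prod.map (last n) id))
      (Kernel.map_frestrictLe_trajMeasure_compProd_eq_map_trajMeasure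
        (X := fun _ => E) (μ₀ := (γ 0).fst) (κ := κ) (a := n))
    rw [map_prodMap_compProd_comap, Measure.map_map (hlast n) (by fun_prop),
      Measure.map_map ((hlast n).prodMap measurable_id) (by fun_prop)] at htraj
    change (P.map (fun x => x n)).compProd _ = P.map (fun x => (x n, x (n + 1))) at htraj
    rw [← htraj, h, (γ n).disintegrate]
  have map_eval (n : ℕ) : P.map (fun x => x n) = (γ n).fst := by
    induction n with
    | zero => exact map_eval_zero_trajMeasure _ _
    | succ n ih =>
      rw [← hγ n, ← map_pair n ih, Measure.snd, Measure.map_map (by fun_prop) (by fun_prop)]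
      rfl
  exact ⟨P, inferInstance, fun n => map_pair n (map_eval n)⟩

end Gluing

/-! ### Carriers of inner regular measures -/

section Carrier

theorem measurableSet_of_isSigmaCompact {X : Type*} [TopologicalSpace X] [T2Space X]
    [MeasurableSpace X] [OpensMeasurableSpace X] {S : Set X} (hS : IsSigmaCompact S) :
    MeasurableSet S := by
  obtain ⟨K, hK, rfl⟩ := hS
  exact .iUnion fun n => (hK n).measurableSet

theorem exists_isSigmaCompact_measure_compl {X : Type*} [TopologicalSpace X] [T2Space X]
    [MeasurableSpace X] [OpensMeasurableSpace X] (μ : Measure X) [IsFiniteMeasure μ]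
    [μ.InnerRegular] : ∃ S : Set X, IsSigmaCompact S ∧ μ Sᶜ = 0 := by
  have h (n : ℕ) : ∃ K : Set X, IsCompact K ∧ μ Kᶜ < (n : ℝ≥0∞)⁻¹ := by
    obtain ⟨K, -, hK, hlt⟩ := MeasurableSet.univ.exists_isCompact_sdiff_lt (measure_ne_top μ _)
      (ENNReal.inv_ne_zero.2 (ENNReal.natCast_ne_top n))
    exact ⟨K, hK, by rwa [← Set.compl_eq_univ_sdiff] at hlt⟩
  choose K hK hμK using h
  refine ⟨⋃ n, K n, isSigmaCompact_iUnion_of_isCompact K hK, le_antisymm ?_ zero_le⟩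
  refine ge_of_tendsto' ENNReal.tendsto_inv_nat_nhds_zero fun n => ?_
  exact (measure_mono (Set.compl_subset_compl.2 (Set.subset_iUnion K n))).trans (hμK n).le

theorem standardBorelSpace_of_measurableEmbedding {α β : Type*} [MeasurableSpace α]
    [MeasurableSpace β] [StandardBorelSpace β] {f : α → β} (hf : MeasurableEmbedding f) :
    StandardBorelSpace α := by
  have := hf.measurableSet_range.standardBorel
  let e := hf.equivRange
  obtain ⟨_, _, _⟩ := StandardBorelSpace.polish (α := Set.range f)
  let : TopologicalSpace α := .induced e inferInstance
  have : BorelSpace α :=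
    ⟨by rw [borel_comap, ← BorelSpace.measurable_eq, e.measurableEmbedding.comap_eq]⟩
  have : PolishSpace α := e.toEquiv.polishSpace_induced
  infer_instance

theorem standardBorelSpace_of_sigmaCompactSpace (X : Type*) [MetricSpace X] [SigmaCompactSpace X]
    [MeasurableSpace X] [BorelSpace X] : StandardBorelSpace X := by
  have hcoe := UniformSpace.Completion.coe_isometry (α := X)
  borelize (UniformSpace.Completion X)
  have : TopologicalSpace.SeparableSpace X := inferInstance
  have : PolishSpace (UniformSpace.Completion X) := inferInstance
  exact standardBorelSpace_of_measurableEmbedding (hcoe.isEmbedding.measurableEmbedding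
    (measurableSet_of_isSigmaCompact (isSigmaCompact_range hcoe.continuous)))

end Carrier

/-! ### The Borel square and couplings -/

/-- The topological product `X × X` with its Borel σ-algebra, on which couplings live. It is a
type synonym because `X × X` carries the product σ-algebra, which may be smaller. -/
def BorelSquare (X : Type*) : Type _ := X × X

namespace BorelSquare

variable {X : Type*}

/-- The first coordinate. -/
def fst (z : BorelSquare X) : X := Prod.fst z

/-- The second coordinate. -/
def snd (z : BorelSquare X) : X := Prod.snd z

/-- The point with coordinates `x` and `y`. -/
def mk (x y : X) : BorelSquare X := (x, y)

variable [MetricSpace X]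

instance : TopologicalSpace (BorelSquare X) := inferInstanceAs (TopologicalSpace (X × X))
instance : MeasurableSpace (BorelSquare X) := borel (X × X)
instance : BorelSpace (BorelSquare X) := ⟨rfl⟩
instance : T1Space (BorelSquare X) := inferInstanceAs (T1Space (X × X))

theorem continuous_fst : Continuous (fst : BorelSquare X → X) := _root_.continuous_fst

theorem continuous_snd : Continuous (snd : BorelSquare X → X) := _root_.continuous_snd

theorem measurable_edist : Measurable fun z : BorelSquare X => edist z.fst z.snd :=
  (continuous_fst.edist continuous_snd).measurable

variable [MeasurableSpace X] [BorelSpace X]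

theorem measurable_fst : Measurable (fst : BorelSquare X → X) := continuous_fst.measurable

theorem measurable_snd : Measurable (snd : BorelSquare X → X) := continuous_snd.measurable

theorem measurableEmbedding_mk {S : Set X} (hS : MeasurableSet S) [SecondCountableTopology S] :
    MeasurableEmbedding fun z : S × S => mk (z.1 : X) (z.2 : X) := by
  have hemb : Topology.IsEmbedding fun z : S × S => mk (z.1 : X) (z.2 : X) :=
    Topology.IsEmbedding.subtypeVal.prodMap Topology.IsEmbedding.subtypeVal
  refine hemb.measurableEmbedding ?_
  convert (measurable_fst hS).inter (measurable_snd hS)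
  ext z
  exact ⟨by rintro ⟨w, rfl⟩; exact ⟨w.1.2, w.2.2⟩, fun h => ⟨(⟨_, h.1⟩, ⟨_, h.2⟩), rfl⟩⟩

end BorelSquare

section Coupling

variable {X : Type*} [MetricSpace X] [MeasurableSpace X]

theorem isCoupling_iff {γ : Measure (BorelSquare X)} {μ ν : Measure X} :
    IsCoupling γ μ ν ↔
      IsProbabilityMeasure γ ∧ γ.map BorelSquare.fst = μ ∧ γ.map BorelSquare.snd = ν :=
  ⟨fun h => ⟨h.1, h.2, h.3⟩, fun h => ⟨h.1, h.2.1, h.2.2⟩⟩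

variable [BorelSpace X]

theorem isCoupling_map {Ω : Type*} [MeasurableSpace Ω] (P : Measure Ω) [IsProbabilityMeasure P]
    {Y Z : Ω → X} (h : Measurable fun ω => BorelSquare.mk (Y ω) (Z ω)) :
    IsCoupling (P.map fun ω => BorelSquare.mk (Y ω) (Z ω) : Measure (BorelSquare X)) (P.map Y)
      (P.map Z) := by
  refine isCoupling_iff.2 ⟨Measure.isProbabilityMeasure_map h.aemeasurable, ?_, ?_⟩
  · exact Measure.map_map BorelSquare.measurable_fst h
  · exact Measure.map_map BorelSquare.measurable_snd h

theorem exists_map_mk_eq_of_isCoupling {S : Set X} (hS : MeasurableSet S)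
    [SecondCountableTopology S] {γ : Measure (BorelSquare X)} {μ ν : Measure X}
    (hγ : IsCoupling γ μ ν) (hμ : μ Sᶜ = 0) (hν : ν Sᶜ = 0) :
    ∃ η : Measure (S × S), IsProbabilityMeasure η ∧ η.fst = μ.comap Subtype.val ∧
      η.snd = ν.comap Subtype.val ∧ η.map (fun z => BorelSquare.mk (z.1 : X) (z.2 : X)) = γ := by
  obtain ⟨hP, rfl, rfl⟩ := isCoupling_iff.1 hγ
  have hmk := BorelSquare.measurableEmbedding_mk hS
  have hval := MeasurableEmbedding.subtype_coe hS
  have hrange : ∀ᵐ z ∂γ, z ∈ Set.range fun z : S × S => BorelSquare.mk (z.1 : X) (z.2 : X) := by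
    filter_upwards [ae_of_ae_map BorelSquare.measurable_fst.aemeasurable (mem_ae_iff.2 hμ),
      ae_of_ae_map BorelSquare.measurable_snd.aemeasurable (mem_ae_iff.2 hν)] with z h₁ h₂
    exact ⟨(⟨_, h₁⟩, ⟨_, h₂⟩), rfl⟩
  have hmap : (γ.comap fun z : S × S => BorelSquare.mk (z.1 : X) (z.2 : X)).map
      (fun z => BorelSquare.mk (z.1 : X) (z.2 : X)) = γ := by
    rw [hmk.map_comap, Measure.restrict_eq_self_of_ae_mem hrange]
  generalize γ.comap (fun z : S × S => BorelSquare.mk (z.1 : X) (z.2 : X)) = η at hmap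
  subst hmap
  refine ⟨η, (Measure.isProbabilityMeasure_map_iff hmk.measurable.aemeasurable).1 hP, ?_, ?_, rfl⟩
  · rw [Measure.map_map BorelSquare.measurable_fst hmk.measurable, ← hval.comap_map η.fst,
      Measure.fst, Measure.map_map hval.measurable measurable_fst]
    rfl
  · rw [Measure.map_map BorelSquare.measurable_snd hmk.measurable, ← hval.comap_map η.snd,
      Measure.snd, Measure.map_map hval.measurable measurable_snd]
    rfl

end Coupling

/-! ### The `L^p` distance of random points -/

section LpDist

open Filter Topology

variable {Ω Ω' : Type*} [MeasurableSpace Ω] [MeasurableSpace Ω'] {p : ℝ}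

/-- The `L^p` distance of two functions with values in a metric space; for random points it is the
`p`-th root of the transport cost of their joint law. -/
def lpDist (p : ℝ) (P : Measure Ω) {E : Type*} [EDist E] (Y Z : Ω → E) : ℝ≥0∞ :=
  (∫⁻ ω, edist (Y ω) (Z ω) ^ p ∂P) ^ (1 / p)

theorem lpDist_map {E : Type*} [EDist E] (P : Measure Ω) {g : Ω → Ω'} (hg : Measurable g)
    {Y Z : Ω' → E} (h : Measurable fun ω => edist (Y ω) (Z ω)) :
    lpDist p (P.map g) Y Z = lpDist p P (Y ∘ g) (Z ∘ g) := by
  rw [lpDist, lintegral_map (h.pow_const p) hg]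
  rfl

theorem lpDist_triangle {E : Type*} [PseudoEMetricSpace E] (hp : 1 ≤ p) (P : Measure Ω)
    {Y Z W : Ω → E} (hYZ : AEMeasurable (fun ω => edist (Y ω) (Z ω)) P)
    (hZW : AEMeasurable (fun ω => edist (Z ω) (W ω)) P) :
    lpDist p P Y W ≤ lpDist p P Y Z + lpDist p P Z W := by
  refine le_trans ?_ (ENNReal.lintegral_Lp_add_le hYZ hZW hp)
  unfold lpDist
  gcongr with ω
  exact edist_triangle _ _ _

variable {E : Type*} [MetricSpace E] [SecondCountableTopology E] [MeasurableSpace E] [BorelSpace E]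
  {P : Measure Ω} {Y : ℕ → Ω → E} {Z : Ω → E}

theorem lpDist_le_sum (hp : 1 ≤ p) (hY : ∀ n, Measurable (Y n)) (n k : ℕ) :
    lpDist p P (Y n) (Y (k + n)) ≤
      ∑ i ∈ Finset.range k, lpDist p P (Y (i + n)) (Y (i + n + 1)) := by
  induction k with
  | zero =>
    have hp₀ : 0 < p := by linarith
    simp [lpDist, hp₀]
  | succ k ih =>
    rw [Finset.sum_range_succ, Nat.add_right_comm]
    exact (lpDist_triangle hp P ((hY n).edist (hY (k + n))).aemeasurable
      ((hY (k + n)).edist (hY (k + n + 1))).aemeasurable).trans (by gcongr)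

theorem lintegral_edist_le_lpDist [IsProbabilityMeasure P] (hp : 1 ≤ p) {Y Z : Ω → E}
    (hY : Measurable Y) (hZ : Measurable Z) :
    ∫⁻ ω, edist (Y ω) (Z ω) ∂P ≤ lpDist p P Y Z := by
  have := eLpNorm'_le_eLpNorm'_of_exponent_le one_pos hp P
    (f := fun ω => edist (Y ω) (Z ω)) (hY.edist hZ).aestronglyMeasurable
  simpa [eLpNorm', lpDist] using this

theorem exists_measurable_tendsto_ae_of_tsum_lpDist_ne_top [CompleteSpace E]
    [IsProbabilityMeasure P] (hp : 1 ≤ p) (hY : ∀ n, Measurable (Y n))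
    (h : ∑' n, lpDist p P (Y n) (Y (n + 1)) ≠ ∞) :
    ∃ Z : Ω → E, Measurable Z ∧ ∀ᵐ ω ∂P, Tendsto (fun n => Y n ω) atTop (𝓝 (Z ω)) := by
  have hm (n : ℕ) : Measurable fun ω => edist (Y n ω) (Y (n + 1) ω) := (hY n).edist (hY (n + 1))
  have hsum : ∫⁻ ω, ∑' n, edist (Y n ω) (Y (n + 1) ω) ∂P ≠ ∞ := by
    rw [lintegral_tsum fun n => (hm n).aemeasurable]
    exact ne_top_of_le_ne_top h
      (ENNReal.tsum_le_tsum fun n => lintegral_edist_le_lpDist hp (hY n) (hY (n + 1)))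
  refine measurable_limit_of_tendsto_metrizable_ae (fun n => (hY n).aemeasurable) ?_
  filter_upwards [ae_lt_top (Measurable.tsum hm) hsum] with ω hω
  exact cauchySeq_tendsto_of_complete
    (cauchySeq_of_edist_le_of_tsum_ne_top _ (fun n => le_rfl) hω.ne)

theorem lpDist_le_of_tendsto_ae (hp : 0 < p) {W : Ω → E} (hW : Measurable W)
    (hY : ∀ n, Measurable (Y n)) (hlim : ∀ᵐ ω ∂P, Tendsto (fun n => Y n ω) atTop (𝓝 (Z ω)))
    {c : ℝ≥0∞} (h : ∀ n, lpDist p P W (Y n) ≤ c) : lpDist p P W Z ≤ c := by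
  have hliminf : ∀ᵐ ω ∂P,
      edist (W ω) (Z ω) ^ p = liminf (fun n => edist (W ω) (Y n ω) ^ p) atTop := by
    filter_upwards [hlim] with ω hω
    exact ((ENNReal.continuous_rpow_const.tendsto _).comp
      (tendsto_const_nhds.edist hω)).liminf_eq.symm
  simp only [lpDist, one_div, ENNReal.rpow_inv_le_iff hp] at h ⊢
  rw [lintegral_congr_ae hliminf]
  exact (lintegral_liminf_le fun n => (hW.edist (hY n)).pow_const p).trans
    (liminf_le_of_le (h := fun b hb => hb.exists.elim fun n hn => hn.trans (h n)))

theorem lpDist_le_tsum_of_tendsto_ae (hp : 1 ≤ p) (hY : ∀ n, Measurable (Y n))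
    (hlim : ∀ᵐ ω ∂P, Tendsto (fun n => Y n ω) atTop (𝓝 (Z ω))) (n : ℕ) :
    lpDist p P (Y n) Z ≤ ∑' k, lpDist p P (Y (k + n)) (Y (k + n + 1)) := by
  refine lpDist_le_of_tendsto_ae (by linarith) (hY n) (fun k => hY (k + n)) ?_
    fun k => (lpDist_le_sum hp hY n k).trans (ENNReal.sum_le_tsum _)
  filter_upwards [hlim] with ω hω
  exact hω.comp (tendsto_add_atTop_nat n)

end LpDist

/-! ### The transport cost -/

section TransportCost

variable {X : Type*} [MetricSpace X] [MeasurableSpace X] {p : ℝ}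

/-- The optimal transport cost, that is, the `p`-th power of the Wasserstein distance. -/
def transportCost (p : ℝ) (μ ν : Measure X) : ℝ≥0∞ :=
  ⨅ (γ : Measure (BorelSquare X)) (_ : IsCoupling γ μ ν), ∫⁻ z, edist z.fst z.snd ^ p ∂γ

theorem wassersteinDist_eq (p : ℝ) (μ ν : Measure X) :
    wassersteinDist p μ ν = transportCost p μ ν ^ (1 / p) := rfl

theorem wassersteinDist_eq_iInf_lpDist (hp : 0 < p) (μ ν : Measure X) :
    wassersteinDist p μ ν = ⨅ (γ : Measure (BorelSquare X)) (_ : IsCoupling γ μ ν),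
      lpDist p γ BorelSquare.fst BorelSquare.snd :=
  (ENNReal.orderIsoRpow (1 / p) (by positivity)).map_iInf₂ _

theorem transportCost_le_of_isCoupling {γ : Measure (BorelSquare X)} {μ ν : Measure X}
    (h : IsCoupling γ μ ν) : transportCost p μ ν ≤ ∫⁻ z, edist z.fst z.snd ^ p ∂γ :=
  iInf₂_le γ h

variable [BorelSpace X]

theorem transportCost_map_le {Ω : Type*} [MeasurableSpace Ω] (P : Measure Ω)
    [IsProbabilityMeasure P] {Y Z : Ω → X}
    (h : Measurable fun ω => BorelSquare.mk (Y ω) (Z ω)) :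
    transportCost p (P.map Y) (P.map Z) ≤ ∫⁻ ω, edist (Y ω) (Z ω) ^ p ∂P :=
  (transportCost_le_of_isCoupling (isCoupling_map P h)).trans_eq
    (lintegral_map (BorelSquare.measurable_edist.pow_const p) h)

theorem wassersteinDist_map_le (hp : 0 ≤ p) {Ω : Type*} [MeasurableSpace Ω] (P : Measure Ω)
    [IsProbabilityMeasure P] {Y Z : Ω → X}
    (h : Measurable fun ω => BorelSquare.mk (Y ω) (Z ω)) :
    wassersteinDist p (P.map Y) (P.map Z) ≤ lpDist p P Y Z :=
  ENNReal.rpow_le_rpow (transportCost_map_le P h) (by positivity)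

theorem transportCost_comm (μ ν : Measure X) : transportCost p μ ν = transportCost p ν μ := by
  suffices ∀ μ ν : Measure X, transportCost p μ ν ≤ transportCost p ν μ from
    le_antisymm (this _ _) (this _ _)
  refine fun μ ν => le_iInf₂ fun γ hγ => ?_
  obtain ⟨hP, rfl, rfl⟩ := isCoupling_iff.1 hγ
  have hswap : Continuous fun z : BorelSquare X => BorelSquare.mk z.snd z.fst := continuous_swap
  refine (transportCost_map_le γ hswap.measurable).trans_eq ?_
  simp only [edist_comm]

theorem transportCost_self (hp : 0 < p) (μ : Measure X) [IsProbabilityMeasure μ] :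
    transportCost p μ μ = 0 := by
  have hdiag : Continuous fun x : X => BorelSquare.mk x x := continuous_id.prodMk continuous_id
  simpa [hp] using transportCost_map_le (p := p) μ (Y := id) (Z := id) hdiag.measurable

theorem transportCost_dirac (x : X) (μ : Measure X) [IsProbabilityMeasure μ] :
    transportCost p (Measure.dirac x) μ = ∫⁻ y, edist x y ^ p ∂μ := by
  refine le_antisymm ?_ (le_iInf₂ fun γ hγ => ?_)
  · have h : Continuous fun y : X => BorelSquare.mk x y := continuous_const.prodMk continuous_id
    simpa using transportCost_map_le (p := p) μ (Y := fun _ => x) (Z := id) h.measurable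
  · obtain ⟨-, hfst, rfl⟩ := isCoupling_iff.1 hγ
    have hx : ∀ᵐ y ∂γ.map BorelSquare.fst, y = x := by simp [hfst, ae_dirac_eq]
    rw [lintegral_map (measurable_edist_right.pow_const p) BorelSquare.measurable_snd]
    refine (lintegral_congr_ae ?_).le
    filter_upwards [ae_of_ae_map BorelSquare.measurable_fst.aemeasurable hx] with z hz
    rw [hz]

theorem measure_le_measure_cthickening_add (hp : 0 < p) (μ ν : Measure X) {F : Set X}
    (hF : MeasurableSet F) {δ : ℝ} (hδ : 0 < δ) :
    μ F ≤ ν (Metric.cthickening δ F) + transportCost p μ ν / ENNReal.ofReal δ ^ p := by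
  have hδ₀ : ENNReal.ofReal δ ^ p ≠ 0 := by simp [hδ, hp]
  have hδ_top : ENNReal.ofReal δ ^ p ≠ ∞ := by simp [hp.le]
  rw [← tsub_le_iff_left, ENNReal.le_div_iff_mul_le (.inl hδ₀) (.inl hδ_top)]
  refine le_iInf₂ fun γ hγ => ?_
  obtain ⟨-, rfl, rfl⟩ := isCoupling_iff.1 hγ
  rw [← ENNReal.le_div_iff_mul_le (.inl hδ₀) (.inl hδ_top), tsub_le_iff_left,
    Measure.map_apply BorelSquare.measurable_fst hF,
    Measure.map_apply BorelSquare.measurable_snd Metric.isClosed_cthickening.measurableSet]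
  have hmarkov := meas_ge_le_lintegral_div (μ := γ)
    (BorelSquare.measurable_edist.pow_const p).aemeasurable hδ₀ hδ_top
  refine (measure_mono fun z hz => ?_).trans ((measure_union_le _ _).trans (by gcongr))
  by_cases hd : ENNReal.ofReal δ ≤ edist z.fst z.snd
  · exact Or.inr (ENNReal.rpow_le_rpow hd hp.le)
  · rw [not_le, edist_comm] at hd
    have hzF : z.fst ∈ F := hz
    exact Or.inl ((Metric.infEDist_le_edist_of_mem hzF).trans hd.le)

theorem measure_le_of_transportCost_eq_zero (hp : 0 < p) {μ ν : Measure X} [IsFiniteMeasure ν]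
    (h : transportCost p μ ν = 0) {F : Set X} (hF : IsClosed F) : μ F ≤ ν F := by
  have hlim := tendsto_measure_cthickening_of_isClosed (μ := ν)
    ⟨1, zero_lt_one, measure_ne_top _ _⟩ hF
  refine ge_of_tendsto (hlim.mono_left (nhdsWithin_le_nhds (s := Set.Ioi 0)))
    (Filter.eventually_of_mem self_mem_nhdsWithin fun δ hδ => ?_)
  simpa [h] using measure_le_measure_cthickening_add hp μ ν hF.measurableSet hδ

theorem eq_of_transportCost_eq_zero (hp : 0 < p) {μ ν : Measure X} [IsProbabilityMeasure μ]
    [IsProbabilityMeasure ν] (h : transportCost p μ ν = 0) : μ = ν := by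
  refine ext_of_generate_finite _ ?_ isPiSystem_isClosed (fun F hF => ?_) (by simp)
  · rw [BorelSpace.measurable_eq (α := X), borel_eq_generateFrom_isClosed]
  · exact le_antisymm (measure_le_of_transportCost_eq_zero hp h hF)
      (measure_le_of_transportCost_eq_zero hp (by rwa [transportCost_comm]) hF)

theorem IsCoupling.smul_add_smul {γ γ' : Measure (BorelSquare X)} {μ ν μ' ν' : Measure X}
    (h : IsCoupling γ μ ν) (h' : IsCoupling γ' μ' ν') {a b : ℝ≥0} (hab : a + b = 1) :
    IsCoupling (a • γ + b • γ' : Measure (BorelSquare X)) (a • μ + b • μ') (a • ν + b • ν') := by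
  obtain ⟨hP, rfl, rfl⟩ := isCoupling_iff.1 h
  obtain ⟨hP', rfl, rfl⟩ := isCoupling_iff.1 h'
  refine isCoupling_iff.2 ⟨⟨?_⟩, ?_, ?_⟩
  · simp only [Measure.coe_add, Measure.coe_nnreal_smul_apply, Pi.add_apply, measure_univ, mul_one]
    rw [← ENNReal.coe_add, hab, ENNReal.coe_one]
  · rw [Measure.map_add _ _ BorelSquare.measurable_fst, Measure.map_smul, Measure.map_smul]
  · rw [Measure.map_add _ _ BorelSquare.measurable_snd, Measure.map_smul, Measure.map_smul]

theorem transportCost_smul_add_smul_le {a b : ℝ≥0} (hab : a + b = 1) (μ μ' ν ν' : Measure X) :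
    transportCost p (a • μ + b • μ') (a • ν + b • ν') ≤
      a * transportCost p μ ν + b * transportCost p μ' ν' := by
  rcases eq_or_ne a 0 with rfl | ha
  · obtain rfl : b = 1 := by simpa using hab
    simp
  rcases eq_or_ne b 0 with rfl | hb
  · obtain rfl : a = 1 := by simpa using hab
    simp
  simp only [transportCost, ENNReal.coe_ne_top, ENNReal.coe_ne_zero.2, ENNReal.mul_iInf_of_ne,
    ne_eq, ha, hb, not_false_eq_true]
  refine ENNReal.le_iInf₂_add_iInf₂ fun γ hγ γ' hγ' =>
    (transportCost_le_of_isCoupling (hγ.smul_add_smul hγ' hab)).trans_eq ?_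
  rw [lintegral_add_measure, lintegral_smul_measure, lintegral_smul_measure]
  rfl

end TransportCost

/-! ### The triangle inequality -/

section Triangle

variable {X : Type*} [MetricSpace X] [MeasurableSpace X] [BorelSpace X] {p : ℝ}

theorem exists_gluing {S : Set X} (hS : MeasurableSet S) [SecondCountableTopology S]
    [StandardBorelSpace S] {μ ν ξ : Measure X} (hμ : μ Sᶜ = 0) (hν : ν Sᶜ = 0)
    (hξ : ξ Sᶜ = 0) {γ γ' : Measure (BorelSquare X)} (hγ : IsCoupling γ μ ν)
    (hγ' : IsCoupling γ' ν ξ) :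
    ∃ P : Measure ((S × S) × S), IsProbabilityMeasure P ∧
      P.map (fun z => BorelSquare.mk (z.1.1 : X) (z.1.2 : X)) = γ ∧
      P.map (fun z => BorelSquare.mk (z.1.2 : X) (z.2 : X)) = γ' := by
  have hmk := (BorelSquare.measurableEmbedding_mk hS).measurable
  obtain ⟨η, _, -, hsnd, rfl⟩ := exists_map_mk_eq_of_isCoupling hS hγ hμ hν
  obtain ⟨η', _, hfst, -, rfl⟩ := exists_map_mk_eq_of_isCoupling hS hγ' hν hξ
  have : Nonempty S := η.nonempty_of_neZero.map Prod.fst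
  obtain ⟨P, hP, rfl, rfl⟩ := exists_measure_fst_eq_map_snd_eq η η' (hsnd.trans hfst.symm)
  refine ⟨P, hP, ?_, ?_⟩
  · exact (Measure.map_map hmk measurable_fst).symm
  · exact (Measure.map_map hmk
      (by fun_prop : Measurable fun z : (S × S) × S => (z.1.2, z.2))).symm

theorem exists_sequence_gluing {S : Set X} (hS : MeasurableSet S) [SecondCountableTopology S]
    [StandardBorelSpace S] {μ : ℕ → Measure X} (hμ : ∀ n, μ n Sᶜ = 0)
    {γ : ℕ → Measure (BorelSquare X)} (hγ : ∀ n, IsCoupling (γ n) (μ n) (μ (n + 1))) :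
    ∃ P : Measure (ℕ → S), IsProbabilityMeasure P ∧
      ∀ n, P.map (fun x => BorelSquare.mk (x n : X) (x (n + 1) : X)) = γ n := by
  have hmk := (BorelSquare.measurableEmbedding_mk hS).measurable
  choose η _ hfst hsnd hη using fun n =>
    exists_map_mk_eq_of_isCoupling hS (hγ n) (hμ n) (hμ (n + 1))
  have : Nonempty S := (η 0).nonempty_of_neZero.map Prod.fst
  obtain ⟨P, hP, hmap⟩ := exists_measure_map_eval_eq η fun n => (hsnd n).trans (hfst (n + 1)).symm
  refine ⟨P, hP, fun n => ?_⟩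
  rw [← hη n, ← hmap n]
  exact (Measure.map_map hmk (by fun_prop : Measurable fun x : ℕ → S => (x n, x (n + 1)))).symm

theorem wassersteinDist_triangle (hp : 1 ≤ p) (μ ν ξ : Measure X) [IsProbabilityMeasure μ]
    [IsProbabilityMeasure ν] [IsProbabilityMeasure ξ] [μ.InnerRegular] [ν.InnerRegular]
    [ξ.InnerRegular] :
    wassersteinDist p μ ξ ≤ wassersteinDist p μ ν + wassersteinDist p ν ξ := by
  have hp₀ : 0 < p := by linarith
  obtain ⟨S, hσ, hnull⟩ := exists_isSigmaCompact_measure_compl (μ + ν + ξ)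
  simp only [Measure.coe_add, Pi.add_apply, add_eq_zero] at hnull
  obtain ⟨⟨hμ, hν⟩, hξ⟩ := hnull
  have hS := measurableSet_of_isSigmaCompact hσ
  have : SigmaCompactSpace S := isSigmaCompact_iff_sigmaCompactSpace.1 hσ
  have := EMetric.secondCountable_of_sigmaCompact S
  have := standardBorelSpace_of_sigmaCompactSpace S
  rw [wassersteinDist_eq_iInf_lpDist hp₀ μ ν, wassersteinDist_eq_iInf_lpDist hp₀ ν ξ]
  refine ENNReal.le_iInf₂_add_iInf₂ fun γ hγ γ' hγ' => ?_
  obtain ⟨P, _, rfl, rfl⟩ := exists_gluing hS hμ hν hξ hγ hγ'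
  have hmk := (BorelSquare.measurableEmbedding_mk hS).measurable
  have h₁ : Measurable fun z : (S × S) × S => BorelSquare.mk (z.1.1 : X) (z.1.2 : X) :=
    hmk.comp measurable_fst
  have h₂ : Measurable fun z : (S × S) × S => BorelSquare.mk (z.1.2 : X) (z.2 : X) :=
    hmk.comp (by fun_prop : Measurable fun z : (S × S) × S => (z.1.2, z.2))
  have h₃ : Measurable fun z : (S × S) × S => BorelSquare.mk (z.1.1 : X) (z.2 : X) :=
    hmk.comp (by fun_prop : Measurable fun z : (S × S) × S => (z.1.1, z.2))
  have h := isCoupling_iff.1 hγ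
  have h' := isCoupling_iff.1 hγ'
  rw [lpDist_map P h₁ BorelSquare.measurable_edist, lpDist_map P h₂ BorelSquare.measurable_edist,
    ← h.2.1, ← h'.2.2, Measure.map_map BorelSquare.measurable_fst h₁,
    Measure.map_map BorelSquare.measurable_snd h₂]
  exact (wassersteinDist_map_le hp₀.le P h₃).trans (lpDist_triangle hp P
    (BorelSquare.measurable_edist.comp h₁).aemeasurable
    (BorelSquare.measurable_edist.comp h₂).aemeasurable)

end Triangle

/-! ### Limits of Cauchy sequences -/

section Completeness

open Filter Topology TopologicalSpace

variable {X : Type*} [MetricSpace X] [MeasurableSpace X] [BorelSpace X] {p : ℝ}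

theorem exists_isClosed_isSeparable_measure_compl {ι : Type*} [Countable ι] (μ : ι → Measure X)
    [∀ i, IsFiniteMeasure (μ i)] [∀ i, (μ i).InnerRegular] :
    ∃ S : Set X, IsClosed S ∧ IsSeparable S ∧ ∀ i, μ i Sᶜ = 0 := by
  choose S hσ hnull using fun i => exists_isSigmaCompact_measure_compl (μ i)
  have hsep (i : ι) : IsSeparable (S i) := by
    have : SigmaCompactSpace (S i) := isSigmaCompact_iff_sigmaCompactSpace.1 (hσ i)
    exact .of_subtype (S i)
  exact ⟨closure (⋃ i, S i), isClosed_closure, (IsSeparable.iUnion hsep).closure, fun i =>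
    measure_mono_null (Set.compl_subset_compl.2 ((Set.subset_iUnion S i).trans subset_closure))
      (hnull i)⟩

theorem exists_random_sequence [CompleteSpace X] (hp : 0 < p) (μ : ℕ → Measure X)
    [∀ n, IsProbabilityMeasure (μ n)] [∀ n, (μ n).InnerRegular] {ε : ℕ → ℝ≥0∞}
    (h : ∀ n, wassersteinDist p (μ n) (μ (n + 1)) < ε n) :
    ∃ S : Set X, IsClosed S ∧ IsSeparable S ∧ ∃ P : Measure (ℕ → S), IsProbabilityMeasure P ∧
      (∀ n, P.map (fun x => (x n : X)) = μ n) ∧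
      ∀ n, lpDist p P (fun x => x n) (fun x => x (n + 1)) < ε n := by
  obtain ⟨S, hS, hsep, hnull⟩ := exists_isClosed_isSeparable_measure_compl μ
  have := hsep.secondCountableTopology
  have : CompleteSpace S := hS.completeSpace_coe
  simp only [wassersteinDist_eq_iInf_lpDist hp, iInf_lt_iff] at h
  choose γ hγ hlt using h
  obtain ⟨P, hP, hmap⟩ := exists_sequence_gluing hS.measurableSet hnull hγ
  have hmk (n : ℕ) : Measurable fun x : ℕ → S => BorelSquare.mk (x n : X) (x (n + 1) : X) :=
    (BorelSquare.measurableEmbedding_mk hS.measurableSet).measurable.comp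
      (by fun_prop : Measurable fun x : ℕ → S => (x n, x (n + 1)))
  refine ⟨S, hS, hsep, P, hP, fun n => ?_, fun n => ?_⟩
  · rw [← (isCoupling_iff.1 (hγ n)).2.1, ← hmap n,
      Measure.map_map BorelSquare.measurable_fst (hmk n)]
    rfl
  · refine lt_of_eq_of_lt ?_ (hlt n)
    rw [← hmap n, lpDist_map P (hmk n) BorelSquare.measurable_edist]
    rfl

theorem exists_forall_wassersteinDist_le_tsum [CompleteSpace X] (hp : 1 ≤ p) (μ : ℕ → Measure X)
    [∀ n, IsProbabilityMeasure (μ n)] [∀ n, (μ n).InnerRegular] {ε : ℕ → ℝ≥0∞}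
    (hε : ∑' n, ε n ≠ ∞) (h : ∀ n, wassersteinDist p (μ n) (μ (n + 1)) < ε n) :
    ∃ ν : Measure X, IsProbabilityMeasure ν ∧ ν.InnerRegular ∧
      ∀ n, wassersteinDist p (μ n) ν ≤ ∑' k, ε (k + n) := by
  have hp₀ : 0 < p := by linarith
  obtain ⟨S, hS, hsep, P, _, hlaw, hlt⟩ := exists_random_sequence hp₀ μ h
  have := hsep.secondCountableTopology
  have : CompleteSpace S := hS.completeSpace_coe
  have heval (n : ℕ) : Measurable fun x : ℕ → S => x n := measurable_pi_apply n
  obtain ⟨Z, hZ, hlim⟩ := exists_measurable_tendsto_ae_of_tsum_lpDist_ne_top hp heval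
    (ne_top_of_le_ne_top hε (ENNReal.tsum_le_tsum fun n => (hlt n).le))
  have : IsProbabilityMeasure (P.map Z) := Measure.isProbabilityMeasure_map hZ.aemeasurable
  refine ⟨(P.map Z).map Subtype.val,
    Measure.isProbabilityMeasure_map measurable_subtype_coe.aemeasurable,
    .map_of_continuous continuous_subtype_val, fun n => ?_⟩
  have hmk : Measurable fun x : ℕ → S => BorelSquare.mk (x n : X) (Z x : X) :=
    (BorelSquare.measurableEmbedding_mk hS.measurableSet).measurable.comp ((heval n).prodMk hZ)
  calc wassersteinDist p (μ n) ((P.map Z).map Subtype.val)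
      = wassersteinDist p (P.map fun x => (x n : X)) (P.map fun x => (Z x : X)) := by
        rw [hlaw, Measure.map_map measurable_subtype_coe hZ]
        rfl
    _ ≤ lpDist p P (fun x => (x n : X)) fun x => (Z x : X) := wassersteinDist_map_le hp₀.le P hmk
    _ = lpDist p P (fun x => x n) Z := rfl
    _ ≤ ∑' k, lpDist p P (fun x => x (k + n)) fun x => x (k + n + 1) :=
        lpDist_le_tsum_of_tendsto_ae hp heval hlim n
    _ ≤ ∑' k, ε (k + n) := ENNReal.tsum_le_tsum fun k => (hlt (k + n)).le

theorem HasFiniteMoment.of_wassersteinDist_ne_top (hp : 1 ≤ p) {μ ν : Measure X}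
    [IsProbabilityMeasure μ] [IsProbabilityMeasure ν] [μ.InnerRegular] [ν.InnerRegular]
    (hμ : HasFiniteMoment p μ) (h : wassersteinDist p μ ν ≠ ∞) : HasFiniteMoment p ν := by
  have hroot : 0 < 1 / p := one_div_pos.2 (by linarith)
  obtain ⟨x₀, hx₀⟩ := hμ
  have := innerRegular_dirac x₀
  refine ⟨x₀, ?_⟩
  rw [← transportCost_dirac] at hx₀ ⊢
  rw [← ENNReal.rpow_lt_top_iff_of_pos hroot, ← wassersteinDist_eq] at hx₀ ⊢
  exact (wassersteinDist_triangle hp _ μ ν).trans_lt (ENNReal.add_lt_top.2 ⟨hx₀, h.lt_top⟩)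

end Completeness

/-! ### The Wasserstein space -/

namespace Pp

variable {p : ℝ} [hp : Fact (1 ≤ p)] {X : Type*} [MetricSpace X] [MeasurableSpace X] [BorelSpace X]

attribute [instance] Pp.isProbabilityMeasure Pp.radon

/-- The Wasserstein distance `W_p`, as an extended metric. -/
scoped instance emetricSpace : EMetricSpace (Pp p X) where
  edist μ ν := wassersteinDist p μ.toMeasure ν.toMeasure
  edist_self μ := by
    have hp₀ : 0 < p := by linarith [hp.out]
    rw [wassersteinDist_eq, transportCost_self hp₀, ENNReal.zero_rpow_of_pos (by positivity)]
  edist_comm μ ν := by rw [wassersteinDist_eq, wassersteinDist_eq, transportCost_comm]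
  edist_triangle μ ν ξ := wassersteinDist_triangle hp.out _ _ _
  eq_of_edist_eq_zero {μ ν} h := by
    have hp₀ : 0 < p := by linarith [hp.out]
    rw [wassersteinDist_eq, ENNReal.rpow_eq_zero_iff_of_pos (by positivity)] at h
    exact Pp.ext (eq_of_transportCost_eq_zero hp₀ h)

theorem edist_eq (μ ν : Pp p X) : edist μ ν = wassersteinDist p μ.toMeasure ν.toMeasure := rfl

theorem edist_rpow (μ ν : Pp p X) :
    edist μ ν ^ p = transportCost p μ.toMeasure ν.toMeasure := by
  have hp₀ : p ≠ 0 := by linarith [hp.out]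
  rw [edist_eq, wassersteinDist_eq, ← ENNReal.rpow_mul, one_div_mul_cancel hp₀, ENNReal.rpow_one]

theorem edist_dirac_rpow (x : X) (μ : Pp p X) :
    edist (dirac p x) μ ^ p = ∫⁻ y, edist x y ^ p ∂μ.toMeasure :=
  (edist_rpow _ _).trans (transportCost_dirac x _)

theorem edist_dirac_lt_top (x : X) (μ : Pp p X) : edist (dirac p x) μ < ∞ := by
  have hp₀ : 0 < p := by linarith [hp.out]
  rw [← ENNReal.rpow_lt_top_iff_of_pos hp₀, edist_dirac_rpow]
  exact μ.hasFiniteMoment.all x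

/-- The Wasserstein distance `W_p`, as a metric. -/
scoped instance metricSpace : MetricSpace (Pp p X) :=
  EMetricSpace.toMetricSpace fun μ ν => by
    obtain ⟨x, -⟩ := μ.hasFiniteMoment
    exact ne_top_of_le_ne_top (ENNReal.add_ne_top.2
      ⟨(edist_dirac_lt_top x μ).ne, (edist_dirac_lt_top x ν).ne⟩) (edist_triangle_left μ ν _)

theorem lipschitzWith_dirac : LipschitzWith 1 (dirac p : X → Pp p X) := by
  have hp₀ : 0 < p := by linarith [hp.out]
  intro x y
  rw [ENNReal.coe_one, one_mul, ← ENNReal.rpow_le_rpow_iff hp₀, edist_dirac_rpow]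
  exact (lintegral_dirac _ _).le

theorem toMeasure_conv (r : unitInterval) (μ ν : Pp p X) :
    (BarycentricAlgebra.conv r μ ν).toMeasure =
      toNNReal r • μ.toMeasure + toNNReal (unitInterval.symm r) • ν.toMeasure := by
  change ENNReal.ofReal r • _ + ENNReal.ofReal (unitInterval.symm r) • _ = _
  rw [ENNReal.ofReal_eq_coe_nnreal r.2.1,
    ENNReal.ofReal_eq_coe_nnreal (unitInterval.symm r).2.1]
  rfl

theorem isWassersteinAlgebra : IsWassersteinAlgebra p (Pp p X) := by
  refine (isWassersteinAlgebra_iff (by linarith [hp.out])).2 fun r μ μ' ν ν' => ?_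
  simp only [edist_rpow, toMeasure_conv]
  exact transportCost_smul_add_smul_le (unitInterval.toNNReal_add_toNNReal_symm r) _ _ _ _

theorem completeSpace [CompleteSpace X] : CompleteSpace (Pp p X) := by
  have hgeom : ∑' n : ℕ, (2⁻¹ : ℝ≥0∞) ^ n ≠ ∞ := by simp [ENNReal.tsum_geometric]
  refine EMetric.complete_of_convergent_controlled_sequences (fun n => 2⁻¹ ^ n)
    (fun n => ENNReal.pow_pos (by simp) n) fun μ hμ => ?_
  obtain ⟨ν, _, hν, hle⟩ := exists_forall_wassersteinDist_le_tsum hp.out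
    (fun n => (μ n).toMeasure) hgeom fun n => hμ n n (n + 1) le_rfl n.le_succ
  have hmoment : HasFiniteMoment p ν := (μ 0).hasFiniteMoment.of_wassersteinDist_ne_top hp.out
    (ne_top_of_le_ne_top hgeom (hle 0))
  refine ⟨⟨ν, inferInstance, hν, hmoment⟩, tendsto_iff_edist_tendsto_0.2 ?_⟩
  exact tendsto_of_tendsto_of_tendsto_of_le_of_le tendsto_const_nhds
    (ENNReal.tendsto_sum_nat_add _ hgeom) (fun _ => zero_le) hle

end Pp

/-! ### Density of finitely supported measures -/

section Approximation

open Filter Topology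

variable {p : ℝ} [Fact (1 ≤ p)] {X : Type*} [MetricSpace X] [MeasurableSpace X] [BorelSpace X]

theorem measurable_mk_simpleFunc (T : SimpleFunc X X) :
    Measurable fun x => BorelSquare.mk x (T x) := fun U hU =>
  T.measurableSet_cut (fun x y => BorelSquare.mk x y ∈ U) fun y => by
    have h : Continuous fun x : X => BorelSquare.mk x y := continuous_id.prodMk continuous_const
    exact h.measurable hU

theorem HasFiniteMoment.exists_simpleFunc_lintegral_edist_lt {μ : Measure X}
    [IsProbabilityMeasure μ] [μ.InnerRegular] (h : HasFiniteMoment p μ) {ε : ℝ≥0∞} (hε : 0 < ε) :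
    ∃ T : SimpleFunc X X, ∫⁻ x, edist x (T x) ^ p ∂μ < ε := by
  have hp₀ : 0 < p := by linarith [Fact.out (p := 1 ≤ p)]
  obtain ⟨S, -, hsep, hnull⟩ := exists_isClosed_isSeparable_measure_compl fun _ : Unit => μ
  have hae : ∀ᵐ x ∂μ, x ∈ S := hnull ()
  obtain ⟨x₀, hx₀⟩ := hae.exists
  have := hsep.separableSpace
  let T (n : ℕ) : SimpleFunc X X := SimpleFunc.approxOn id measurable_id S x₀ hx₀ n
  have hmeas (n : ℕ) : Measurable fun x => edist x (T n x) ^ p :=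
    (BorelSquare.measurable_edist.pow_const p).comp (measurable_mk_simpleFunc (T n))
  have hbound (n : ℕ) : ∀ᵐ x ∂μ, edist x (T n x) ^ p ≤ edist x₀ x ^ p := .of_forall fun x => by
    rw [edist_comm x]
    exact ENNReal.rpow_le_rpow (SimpleFunc.edist_approxOn_le measurable_id hx₀ x n) hp₀.le
  have hlim : ∀ᵐ x ∂μ, Tendsto (fun n => edist x (T n x) ^ p) atTop (𝓝 0) := by
    filter_upwards [hae] with x hx
    have hT : Tendsto (fun n => T n x) atTop (𝓝 x) :=
      SimpleFunc.tendsto_approxOn measurable_id hx₀ (subset_closure hx)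
    have := ((ENNReal.continuous_rpow_const (y := p)).tendsto _).comp
      ((tendsto_const_nhds (x := x)).edist hT)
    rwa [edist_self, ENNReal.zero_rpow_of_pos hp₀] at this
  have hint := tendsto_lintegral_of_dominated_convergence _ hmeas hbound (h.all x₀).ne hlim
  rw [lintegral_zero] at hint
  obtain ⟨n, hn⟩ := (hint.eventually (gt_mem_nhds hε)).exists
  exact ⟨T n, hn⟩

theorem hasFiniteMoment_discreteMeasure [Nonempty X] (w : X →₀ ℝ≥0) :
    HasFiniteMoment p (discreteMeasure w) := by
  have hp₀ : 0 ≤ p := by linarith [Fact.out (p := 1 ≤ p)]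
  obtain ⟨x₀⟩ := ‹Nonempty X›
  refine ⟨x₀, ?_⟩
  rw [lintegral_discreteMeasure]
  exact ENNReal.sum_lt_top.2 fun x _ => ENNReal.mul_lt_top ENNReal.coe_lt_top
    (ENNReal.rpow_lt_top_of_nonneg hp₀ (edist_ne_top _ _))

end Approximation

namespace Pp

variable {p : ℝ} [hp : Fact (1 ≤ p)] {X : Type*} [MetricSpace X] [MeasurableSpace X] [BorelSpace X]

/-- The finitely supported measures in `Pp p X`. -/
def finitelySupported (p : ℝ) (X : Type*) [MetricSpace X] [MeasurableSpace X] : Set (Pp p X) :=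
  {μ | μ.toMeasure ∈ LinearMap.range (discreteMeasure (Ω := X))}

theorem dirac_mem_finitelySupported (x : X) : dirac p x ∈ finitelySupported p X :=
  ⟨Finsupp.single x 1, (discreteMeasure_single x 1).trans (one_smul _ _)⟩

theorem conv_mem_finitelySupported (r : unitInterval) {μ ν : Pp p X}
    (hμ : μ ∈ finitelySupported p X) (hν : ν ∈ finitelySupported p X) :
    BarycentricAlgebra.conv r μ ν ∈ finitelySupported p X := by
  rw [finitelySupported, Set.mem_ofPred_eq, toMeasure_conv]
  exact add_mem (Submodule.smul_mem _ _ hμ) (Submodule.smul_mem _ _ hν)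

theorem dense_finitelySupported : Dense (finitelySupported p X) := by
  have hp₀ : 0 < p := by linarith [hp.out]
  refine fun μ => EMetric.mem_closure_iff.2 fun ε hε => ?_
  obtain ⟨T, hT⟩ := μ.hasFiniteMoment.exists_simpleFunc_lintegral_edist_lt
    (ENNReal.rpow_pos_of_nonneg hε hp₀.le)
  have hprob : IsProbabilityMeasure (μ.toMeasure.map T) :=
    Measure.isProbabilityMeasure_map T.measurable.aemeasurable
  have : Nonempty X := μ.toMeasure.nonempty_of_neZero
  obtain ⟨w, hw⟩ : μ.toMeasure.map T ∈ LinearMap.range (discreteMeasure (Ω := X)) := by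
    refine mem_range_discreteMeasure_of_measure_compl T.finite_range ?_
    rw [Measure.map_apply T.measurable T.finite_range.measurableSet.compl, Set.preimage_compl,
      Set.preimage_range, Set.compl_univ, measure_empty]
  refine ⟨⟨discreteMeasure w, hw ▸ hprob, innerRegular_discreteMeasure w,
    hasFiniteMoment_discreteMeasure w⟩, ⟨w, rfl⟩, ?_⟩
  rw [← ENNReal.rpow_lt_rpow_iff hp₀, edist_rpow]
  calc transportCost p μ.toMeasure (discreteMeasure w)
      = transportCost p (μ.toMeasure.map id) (μ.toMeasure.map T) := by rw [hw, Measure.map_id]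
    _ ≤ ∫⁻ x, edist x (T x) ^ p ∂μ.toMeasure :=
        transportCost_map_le _ (measurable_mk_simpleFunc T)
    _ < ε ^ p := hT

end Pp

/-! ### Barycenters of finitely supported measures -/

theorem Cone.exists_ι_eq_linearCombination {A I : Type*} [BarycentricAlgebra A] (x : I → A)
    {w : I →₀ ℝ≥0} (hw : w.sum (fun _ c => c) = 1) :
    ∃ a : A, ι a = Finsupp.linearCombination ℝ≥0 (ι ∘ x) w := by
  refine exists_ι_eq ?_
  rw [Finsupp.apply_linearCombination, ← hw]
  simp only [Finsupp.linearCombination_apply, Function.comp_apply, mass_ι, smul_eq_mul, mul_one]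

section DiscreteTransport

open Cone

variable {p : ℝ} {X : Type*} [MetricSpace X] [MeasurableSpace X] [BorelSpace X]

theorem IsCoupling.mem_range_discreteMeasure {v w : X →₀ ℝ≥0} {γ : Measure (BorelSquare X)}
    (h : IsCoupling γ (discreteMeasure v) (discreteMeasure w)) :
    γ ∈ LinearMap.range (discreteMeasure (Ω := BorelSquare X)) := by
  obtain ⟨_, hfst, hsnd⟩ := isCoupling_iff.1 h
  have hfinite : (BorelSquare.fst ⁻¹' v.support ∩ BorelSquare.snd ⁻¹' w.support :
      Set (BorelSquare X)).Finite := v.support.finite_toSet.prod w.support.finite_toSet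
  refine mem_range_discreteMeasure_of_measure_compl hfinite ?_
  rw [Set.compl_inter]
  refine measure_union_null ?_ ?_
  · rw [← Set.preimage_compl, ← Measure.map_apply BorelSquare.measurable_fst
      v.support.measurableSet.compl, hfst, discreteMeasure_compl_support]
  · rw [← Set.preimage_compl, ← Measure.map_apply BorelSquare.measurable_snd
      w.support.measurableSet.compl, hsnd, discreteMeasure_compl_support]

variable {B : Type*} [MetricSpace B] [BarycentricAlgebra B]

theorem edist_rpow_le_transportCost_discreteMeasure (hp : 0 < p) (hB : IsWassersteinAlgebra p B)
    {f : X → B} (hf : LipschitzWith 1 f) {v w : X →₀ ℝ≥0} {a b : B}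
    (ha : ι a = Finsupp.linearCombination ℝ≥0 (ι ∘ f) v)
    (hb : ι b = Finsupp.linearCombination ℝ≥0 (ι ∘ f) w) :
    edist a b ^ p ≤ transportCost p (discreteMeasure v) (discreteMeasure w) := by
  refine le_iInf₂ fun γ hγ => ?_
  obtain ⟨q, rfl⟩ := hγ.mem_range_discreteMeasure
  obtain ⟨-, hfst, hsnd⟩ := isCoupling_iff.1 hγ
  rw [map_discreteMeasure BorelSquare.measurable_fst, discreteMeasure_injective.eq_iff] at hfst
  rw [map_discreteMeasure BorelSquare.measurable_snd, discreteMeasure_injective.eq_iff] at hsnd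
  rw [← hfst, Finsupp.linearCombination_mapDomain] at ha
  rw [← hsnd, Finsupp.linearCombination_mapDomain] at hb
  calc edist a b ^ p = cost p (ι a) (ι b) := by simpa using (cost_smul_ι (p := p) 1 a b).symm
    _ ≤ q.sum fun z c => c * edist (f z.fst) (f z.snd) ^ p := by
        rw [ha, hb]
        exact cost_linearCombination_le hp hB q (f ∘ BorelSquare.fst) (f ∘ BorelSquare.snd)
    _ = ∫⁻ z, edist (f z.fst) (f z.snd) ^ p ∂discreteMeasure q :=
        (lintegral_discreteMeasure q _).symm
    _ ≤ ∫⁻ z, edist z.fst z.snd ^ p ∂discreteMeasure q := by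
        gcongr with z
        simpa using hf z.fst z.snd

end DiscreteTransport

namespace Pp

open Cone

variable {p : ℝ} {X : Type*} [MetricSpace X] [MeasurableSpace X] [BorelSpace X]

theorem exists_barycenter {B : Type*} [BarycentricAlgebra B] (f : X → B)
    (μ : finitelySupported p X) : ∃ b : B, ∀ w : X →₀ ℝ≥0,
      discreteMeasure w = μ.1.toMeasure → ι b = Finsupp.linearCombination ℝ≥0 (ι ∘ f) w := by
  obtain ⟨w, hw⟩ := μ.2
  have : IsProbabilityMeasure (discreteMeasure w) := by rw [hw]; infer_instance
  obtain ⟨b, hb⟩ := exists_ι_eq_linearCombination f (sum_eq_one_of_isProbabilityMeasure (w := w))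
  refine ⟨b, fun w' hw' => ?_⟩
  rw [hb, discreteMeasure_injective (hw.trans hw'.symm)]

/-- The barycenter of the image under `f` of a finitely supported measure: the measure
`∑ cᵢ δ_{xᵢ}` has as barycenter the convex combination of the points `f xᵢ` with weights `cᵢ`. -/
def barycenter {B : Type*} [BarycentricAlgebra B] (f : X → B) (μ : finitelySupported p X) : B :=
  (exists_barycenter f μ).choose

theorem ι_barycenter {B : Type*} [BarycentricAlgebra B] (f : X → B) {μ : finitelySupported p X}
    {w : X →₀ ℝ≥0} (hw : discreteMeasure w = μ.1.toMeasure) :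
    ι (barycenter f μ) = Finsupp.linearCombination ℝ≥0 (ι ∘ f) w :=
  (exists_barycenter f μ).choose_spec w hw

section Affine

variable [hp : Fact (1 ≤ p)] {B : Type*} [BarycentricAlgebra B]

theorem barycenter_dirac (f : X → B) (x : X) :
    barycenter f ⟨dirac p x, dirac_mem_finitelySupported x⟩ = f x := by
  apply ι_injective
  rw [ι_barycenter f (w := Finsupp.single x 1)
    ((discreteMeasure_single x 1).trans (one_smul _ _)), Finsupp.linearCombination_single, one_smul]
  rfl

theorem barycenter_conv (f : X → B) (r : unitInterval) (μ ν : finitelySupported p X) :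
    barycenter f ⟨BarycentricAlgebra.conv r μ.1 ν.1, conv_mem_finitelySupported r μ.2 ν.2⟩ =
      BarycentricAlgebra.conv r (barycenter f μ) (barycenter f ν) := by
  obtain ⟨v, hv⟩ := μ.2
  obtain ⟨w, hw⟩ := ν.2
  apply ι_injective
  rw [preservesConv_ι, ι_barycenter f hv, ι_barycenter f hw, ← map_smul, ← map_smul, ← map_add]
  exact ι_barycenter f (by rw [map_add, map_smul, map_smul, hv, hw, toMeasure_conv])

theorem ι_eq_linearCombination_dirac {μ : Pp p X} {w : X →₀ ℝ≥0}
    (hw : discreteMeasure w = μ.toMeasure) :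
    ι μ = Finsupp.linearCombination ℝ≥0 (ι ∘ dirac p) w := by
  have : IsProbabilityMeasure (discreteMeasure w) := by rw [hw]; infer_instance
  obtain ⟨μ', hμ'⟩ :=
    exists_ι_eq_linearCombination (dirac p) (sum_eq_one_of_isProbabilityMeasure (w := w))
  have hμ : μ'.toMeasure = discreteMeasure w := by
    rw [← lift_ι toMeasure toMeasure_conv μ', hμ', Finsupp.apply_linearCombination]
    exact congrArg (Finsupp.linearCombination ℝ≥0 · w)
      (funext fun x => lift_ι toMeasure toMeasure_conv (dirac p x))
  rw [← hμ', Pp.ext (hμ.trans hw)]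

theorem apply_eq_barycenter_of_isAffine {h : Pp p X → B} (hh : IsAffine h)
    (μ : finitelySupported p X) : h μ = barycenter (h ∘ dirac p) μ := by
  obtain ⟨w, hw⟩ := μ.2
  apply ι_injective
  rw [ι_barycenter _ hw, ← lift_ι _ (isAffine_iff_preservesConv.1 hh) μ.1,
    ι_eq_linearCombination_dirac hw, Finsupp.apply_linearCombination]
  simp only [Function.comp_def, lift_ι]

end Affine

theorem lipschitzWith_barycenter [hp : Fact (1 ≤ p)] {B : Type*} [MetricSpace B]
    [BarycentricAlgebra B] (hB : IsWassersteinAlgebra p B) {f : X → B} (hf : LipschitzWith 1 f) :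
    LipschitzWith 1 (barycenter f : finitelySupported p X → B) := fun μ ν => by
  have hp₀ : 0 < p := by linarith [hp.out]
  obtain ⟨v, hv⟩ := μ.2
  obtain ⟨w, hw⟩ := ν.2
  rw [ENNReal.coe_one, one_mul, ← ENNReal.rpow_le_rpow_iff hp₀, Subtype.edist_eq, edist_rpow,
    ← hv, ← hw]
  exact edist_rpow_le_transportCost_discreteMeasure hp₀ hB hf (ι_barycenter f hv)
    (ι_barycenter f hw)

end Pp

/-! ### The universal property -/

theorem isAffine_of_dense {A B : Type*} [TopologicalSpace A] [BarycentricAlgebra A]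
    [TopologicalSpace B] [T2Space B] [BarycentricAlgebra B]
    (hA : ∀ r, Continuous fun z : A × A => conv r z.1 z.2)
    (hB : ∀ r, Continuous fun z : B × B => conv r z.1 z.2) {s : Set A} (hs : Dense s) {h : A → B}
    (hh : Continuous h) (hconv : ∀ r, ∀ x ∈ s, ∀ y ∈ s, h (conv r x y) = conv r (h x) (h y)) :
    IsAffine h := fun r x y =>
  congrFun (Continuous.ext_on (hs.prod hs) (hh.comp (hA r)) ((hB r).comp (hh.prodMap hh))
    fun z hz => hconv r z.1 hz.1 z.2 hz.2) (x, y)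

theorem Pp.existsUnique_extension {p : ℝ} [Fact (1 ≤ p)] {X : Type*} [MetricSpace X]
    [MeasurableSpace X] [BorelSpace X] {B : Type*} [MetricSpace B] [BarycentricAlgebra B]
    [CompleteSpace B] (hB : IsWassersteinAlgebra p B) {f : X → B} (hf : LipschitzWith 1 f) :
    ∃! h : Pp p X → B, LipschitzWith 1 h ∧ IsAffine h ∧ ∀ x, h (dirac p x) = f x := by
  have hd : Dense (finitelySupported p X) := dense_finitelySupported
  have hlip : LipschitzWith 1 (barycenter f : finitelySupported p X → B) :=
    lipschitzWith_barycenter hB hf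
  have hext := hd.extend_eq hlip.continuous
  have hlip' := hd.lipschitzWith_extend hlip
  refine ⟨hd.extend (barycenter f), ⟨hlip', ?_, fun x => ?_⟩, fun h ⟨hh, haff, hdirac⟩ => ?_⟩
  · refine isAffine_of_dense (fun r => (isWassersteinAlgebra.nonexpansive r).continuous)
      (fun r => (hB.nonexpansive r).continuous) hd hlip'.continuous fun r μ hμ ν hν => ?_
    rw [hext ⟨μ, hμ⟩, hext ⟨ν, hν⟩, hext ⟨_, conv_mem_finitelySupported r hμ hν⟩,
      barycenter_conv f r ⟨μ, hμ⟩ ⟨ν, hν⟩]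
  · rw [hext ⟨_, dirac_mem_finitelySupported x⟩, barycenter_dirac]
  · refine Continuous.ext_on hd hh.continuous hlip'.continuous fun μ hμ => ?_
    rw [hext ⟨μ, hμ⟩, apply_eq_barycenter_of_isAffine haff ⟨μ, hμ⟩]
    exact congrArg (barycenter · _) (funext hdirac)

end WassersteinAlgebra

end

theorem mainTheorem1 (p : ℝ) [Fact (1 ≤ p)] (X : Type u) [MetricSpace X] [CompleteSpace X]
    [MeasurableSpace X] [BorelSpace X] :
    ∃ _ : MetricSpace (WassersteinAlgebra.Pp p X),
      (∀ μ ν : WassersteinAlgebra.Pp p X,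
        edist μ ν = WassersteinAlgebra.wassersteinDist p μ.toMeasure ν.toMeasure) ∧
      WassersteinAlgebra.IsFreeCompleteWassersteinAlgebra.{u, u, v} p
        (WassersteinAlgebra.Pp.dirac p : X → WassersteinAlgebra.Pp p X) := by
  let := WassersteinAlgebra.Pp.metricSpace (p := p) (X := X)
  exact ⟨this, WassersteinAlgebra.Pp.edist_eq,
    { complete := WassersteinAlgebra.Pp.completeSpace
      isWassersteinAlgebra := WassersteinAlgebra.Pp.isWassersteinAlgebra
      nonexpansive := WassersteinAlgebra.Pp.lipschitzWith_dirac
      existsUnique_extension := fun _ _ _ _ hB _ hf =>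
        WassersteinAlgebra.Pp.existsUnique_extension hB hf }⟩
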